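/- Let $n\ge 2$, $m\ge 3$, $\theta>0$, let $\varepsilon_i=\pm1$ ($1\le i\le n$) and $\delta_j=\pm1$ ($1\le j\le m$), and let $g_0$ denote the semi-Euclidean metrics $\sum\varepsilon_i\,dx_i^2$ on $\mathbb R^n$ and $\sum\delta_j\,dy_j^2$ on $\mathbb R^m$. Let $\alpha\in\mathbb R^n$, $\beta\in\mathbb R^m$ be nonzero, $\xi=\sum\alpha_ix_i$, $\zeta=\sum\beta_jy_j$, $\|\alpha\|^2=\sum\varepsilon_i\alpha_i^2$, $\|\beta\|^2=\sum\delta_j\beta_j^2$. Let $I,J\subset\mathbb R$ be open intervals, $\xi_0\in I$, $\zeta_0\in J$, let $\varphi,f>0$ and $h$ be smooth functions of $\xi\in I$, and let $\tau>0$ and $u$ be smooth functions of $\zeta\in J$, with $u$ non-constant. On $\{\xi\in I\}\times\{\zeta\in J\}\subset\mathbb R^n\times\mathbb R^m$ consider the warped product metric $g=\varphi^{-2}g_0+f^2\tau^{-2}g_0$, and on $\{\zeta\in J\}$ the fiber metric $g_F=\tau^{-2}g_0$. Let (S) be the assertion that $g$, with potential $h(\xi)$ and map $u(\zeta)$, is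 a steady gradient Ricci-harmonic soliton, i.e. $$Ric_g+Hess_g\,h-\theta\,du\otimes du=0,\qquad \Delta_g u-g(\nabla u,\nabla h)=0,$$ and that the fiber is steady harmonic-Einstein, i.e. $Ric_{g_F}-\theta\,du\otimes du=0$, $\Delta_{g_F}u=0$. Consider the following conditions (the quantifiers range over real constants, and the equations hold on $I$ or $J$ respectively). (B0) There are $c_1,c_2\in\mathbb R$ with $$h(\xi)=\int_{\xi_0}^{\xi}\varphi^{-2}\Big[\int_{\xi_0}^{s}\Big(m\tfrac{f''}{f}\varphi^2+2m\varphi\varphi'\tfrac{f'}{f}-(n-2)\varphi\varphi''\Big)dr+c_1\Big]ds+c_2 .$$ (F0) $\tau''/\tau\ge0$, and there are $c_3\in\mathbb R$ and a function $\sigma:J\to\{1,-1\}$ such that $\sigma\sqrt{\tfrac{m-2}{\theta}\tfrac{\tau''}{\tau}}$ is continuous and $$u(\zeta)=\int_{\zeta_0}^{\zeta}\sigma\sqrt{\tfrac{m-2}{\theta}\tfrac{\tau''}{\tau}}\,ds+c_3 .$$ (F1) There are $c_1,c_3\in\mathbb R$, $c_2>0$ and a sign $\pm$ such that, with $\ell(\zeta)=(m-2)\zeta+c_1$,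 $\ell\ne0$ on $J$ and $$\tau(\zeta)=c_2|\ell(\zeta)|^{\frac1{2-m}},\qquad u(\zeta)=c_3\pm\frac{\sqrt{2-3m+m^2}\;\ell(\zeta)\log|\ell(\zeta)|}{(m-2)\sqrt{\theta\,\ell(\zeta)^2}} .$$ (B1) There are $k\in\mathbb R$ and a smooth function $z$ on $I$ with $\varphi'/\varphi=k\,f'/f$ and $h'+[(n-2)k-m]f'/f=z\,f'/f$, such that, with $D=\sqrt{m+k^2(n-1)}$, $N_\pm=-k\pm D$, $a=k/D$, one of the following holds. (i) $z$ is a nonzero constant, and there are $N\in\{N_+,N_-\}$, $c_4,c_5>0$ and $b,c_7\in\mathbb R$ with $N\xi+b\neq0$ on $I$ and $$\varphi=\frac{c_4}{|N\xi+b|^{k/N}},\quad f=\frac{c_5}{|N\xi+b|^{1/N}},\quad h=-\frac{m-(n-2)k+N}{N}\ln|N\xi+b|+c_7 .$$ (ii) $z$ is non-constant, $z+k-D$ and $z+k+D$ have no zeros on $I$, and there are $c_6\in\mathbb R$ and a function $\psi$ with $$\frac{\varphi'}{\varphi}=k\frac{f'}{f},\qquad \frac{f'}{f}=\psi,\qquad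 h'=[z+m-k(n-2)]\psi,$$ $$\psi=c_6\,|z+k-D|^{\frac{a-1}2}\,|z+k+D|^{\frac{-a-1}2},\qquad z'=-c_6\,(z+k-D)^{[\frac{a+1}2]}\,(z+k+D)^{[\frac{-a+1}2]},$$ where $x^{[p]}=\operatorname{sgn}(x)|x|^p$ (the ordinary power when $x>0$). Then: 1. If $\|\alpha\|^2=0$ and $\|\beta\|^2=0$, then (S) holds if and only if (B0) and (F0) hold. 2. If $\|\alpha\|^2=0$ and $\|\beta\|^2=1$, then (S) holds if and only if (B0) and (F1) hold. 3. If $\|\alpha\|^2=1$, $\|\beta\|^2=0$ and $f$ is non-constant, then (S) holds if and only if (B1) and (F0) hold. 4. If $\|\alpha\|^2=1$, $\|\beta\|^2=1$ and $f$ is non-constant, then (S) holds if and only if (B1) and (F1) hold. -/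

import Mathlib

open scoped ContDiff

noncomputable section

namespace RicciHarmonic

section Coordinates

variable {ι : Type*} [Fintype ι] [DecidableEq ι]

/-- The partial derivative `∂F/∂xᵢ`. -/
def pd (i : ι) (F : (ι → ℝ) → ℝ) (x : ι → ℝ) : ℝ :=
  fderiv ℝ F x (Pi.single i 1)

/-- `g` is a (smooth) semi-Riemannian metric on the open set `U`, given by its components
`g x i j` in the standard coordinates. -/
structure IsMetricOn (U : Set (ι → ℝ)) (g : (ι → ℝ) → Matrix ι ι ℝ) : Prop where
  isOpen : IsOpen U
  smooth : ∀ i j, ContDiffOn ℝ ∞ (fun x => g x i j) U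
  symm : ∀ x ∈ U, (g x).IsSymm
  nondegenerate : ∀ x ∈ U, (g x).det ≠ 0

/-- Christoffel symbols `Γᵏᵢⱼ` of the Levi-Civita connection of `g`. -/
def christoffel (g : (ι → ℝ) → Matrix ι ι ℝ) (k i j : ι) (x : ι → ℝ) : ℝ :=
  (1 / 2) * ∑ l, (g x)⁻¹ k l *
    (pd i (fun y => g y j l) x + pd j (fun y => g y i l) x - pd l (fun y => g y i j) x)

/-- Components of the Ricci tensor of `g`. -/
def ricci (g : (ι → ℝ) → Matrix ι ι ℝ) (i j : ι) (x : ι → ℝ) : ℝ :=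
  ∑ k, (pd k (christoffel g k i j) x - pd j (christoffel g k i k) x) +
    ∑ k, ∑ l, (christoffel g k k l x * christoffel g l i j x -
      christoffel g k j l x * christoffel g l i k x)

/-- Components of the Hessian (second covariant derivative) of `F`. -/
def hess (g : (ι → ℝ) → Matrix ι ι ℝ) (F : (ι → ℝ) → ℝ) (i j : ι) (x : ι → ℝ) : ℝ :=
  pd i (pd j F) x - ∑ k, christoffel g k i j x * pd k F x

/-- The tension field of a real valued function, i.e. the trace of its Hessian. -/
def tension (g : (ι → ℝ) → Matrix ι ι ℝ) (F : (ι → ℝ) → ℝ) (x : ι → ℝ) : ℝ :=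
  ∑ i, ∑ j, (g x)⁻¹ i j * hess g F i j x

/-- The inner product `g(∇F, ∇G)` of two gradients. -/
def gradInner (g : (ι → ℝ) → Matrix ι ι ℝ) (F G : (ι → ℝ) → ℝ) (x : ι → ℝ) : ℝ :=
  ∑ i, ∑ j, (g x)⁻¹ i j * pd i F x * pd j G x

/-- `(U, g)` with potential `h`, real valued map `u`, coupling constant `θ` and constant `lam` is
a gradient Ricci-harmonic soliton. -/
structure IsGRHS (U : Set (ι → ℝ)) (g : (ι → ℝ) → Matrix ι ι ℝ) (h u : (ι → ℝ) → ℝ)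
    (θ lam : ℝ) : Prop where
  metric : IsMetricOn U g
  smooth_h : ContDiffOn ℝ ∞ h U
  smooth_u : ContDiffOn ℝ ∞ u U
  theta_nonneg : 0 ≤ θ
  soliton : ∀ x ∈ U, ∀ i j,
    ricci g i j x + hess g h i j x - θ * (pd i u x * pd j u x) = lam * g x i j
  harmonic : ∀ x ∈ U, tension g u x - gradInner g u h x = 0

/-- `(U, g)` with the real valued map `u` is harmonic-Einstein with constant `ρ`. -/
structure IsHarmonicEinstein (U : Set (ι → ℝ)) (g : (ι → ℝ) → Matrix ι ι ℝ)
    (u : (ι → ℝ) → ℝ) (θ ρ : ℝ) : Prop where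
  metric : IsMetricOn U g
  smooth_u : ContDiffOn ℝ ∞ u U
  theta_nonneg : 0 ≤ θ
  einstein : ∀ x ∈ U, ∀ i j, ricci g i j x - θ * (pd i u x * pd j u x) = ρ * g x i j
  harmonic : ∀ x ∈ U, tension g u x = 0

/-- The metric `φ⁻² g₀`, conformal to the semi-Euclidean metric `(g₀)ᵢⱼ = εᵢ δᵢⱼ`. -/
def conformalMetric (ε : ι → ℝ) (φ : (ι → ℝ) → ℝ) (x : ι → ℝ) : Matrix ι ι ℝ :=
  Matrix.diagonal fun i => ε i / φ x ^ 2

/-- The linear function `x ↦ ∑ αᵢ xᵢ`. -/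
def lin (α : ι → ℝ) (x : ι → ℝ) : ℝ := ∑ i, α i * x i

/-- The semi-Euclidean square norm `‖α‖² = ∑ εᵢ αᵢ²`. -/
def sqNorm (ε α : ι → ℝ) : ℝ := ∑ i, ε i * α i ^ 2

end Coordinates

/-- The warped product metric `π^* g_B + (f ∘ π)² σ^* g_F` on the product. -/
def warpedMetric {ι κ : Type*} (gB : (ι → ℝ) → Matrix ι ι ℝ) (f : (ι → ℝ) → ℝ)
    (gF : (κ → ℝ) → Matrix κ κ ℝ) (x : ι ⊕ κ → ℝ) : Matrix (ι ⊕ κ) (ι ⊕ κ) ℝ :=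
  Matrix.fromBlocks (gB (x ∘ Sum.inl)) 0 0 (f (x ∘ Sum.inl) ^ 2 • gF (x ∘ Sum.inr))

/-- The warped product of the base `({ξ ∈ I}, φ(ξ)⁻² g₀)` and the fiber `({ζ ∈ J}, τ(ζ)⁻² g₀)`
with warping function `f(ξ)`, where `ξ = ∑ αᵢ xᵢ` and `ζ = ∑ βⱼ yⱼ`, is a steady gradient
Ricci-harmonic soliton with potential `h(ξ)` and map `u(ζ)`, and its fiber is steady
harmonic-Einstein. -/
def IsSteadyWithSteadyFiber {n m : ℕ} (ε α : Fin n → ℝ) (δ β : Fin m → ℝ) (θ : ℝ)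
    (I J : Set ℝ) (φ f h τ u : ℝ → ℝ) : Prop :=
  IsGRHS {x : Fin n ⊕ Fin m → ℝ | lin α (x ∘ Sum.inl) ∈ I ∧ lin β (x ∘ Sum.inr) ∈ J}
      (warpedMetric (conformalMetric ε fun p => φ (lin α p)) (fun p => f (lin α p))
        (conformalMetric δ fun q => τ (lin β q)))
      (fun x => h (lin α (x ∘ Sum.inl))) (fun x => u (lin β (x ∘ Sum.inr))) θ 0 ∧
    IsHarmonicEinstein {q : Fin m → ℝ | lin β q ∈ J}
      (conformalMetric δ fun q => τ (lin β q)) (fun q => u (lin β q)) θ 0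

/-- `s` is not constant on `I`. -/
def NonConstOn (s : ℝ → ℝ) (I : Set ℝ) : Prop := ∃ x ∈ I, ∃ y ∈ I, s x ≠ s y

/-- The signed power `sgn(x) |x|^p`; it is the ordinary power for `x > 0`. -/
def signedPow (x p : ℝ) : ℝ := Real.sign x * |x| ^ p

/-- The base functions when `‖α‖² = 0`: `h` is given by two integrations from `φ` and `f`. -/
def BaseNull (n m : ℕ) (I : Set ℝ) (ξ₀ : ℝ) (φ f h : ℝ → ℝ) : Prop :=
  ∃ c₁ c₂ : ℝ, ∀ ξ ∈ I,
    h ξ = (∫ s in ξ₀..ξ, (φ s ^ 2)⁻¹ *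
      ((∫ r in ξ₀..s, ((m : ℝ) * (deriv (deriv f) r / f r) * φ r ^ 2
          + 2 * m * φ r * deriv φ r * (deriv f r / f r)
          - ((n : ℝ) - 2) * φ r * deriv (deriv φ) r)) + c₁)) + c₂

/-- The fiber functions when `‖β‖² = 0`: `u` is an integral of `± √((m-2)/θ · τ''/τ)`, where the
radicand is nonnegative and the sign is chosen pointwise so that the integrand is continuous. -/
def FiberNull (m : ℕ) (θ : ℝ) (J : Set ℝ) (ζ₀ : ℝ) (τ u : ℝ → ℝ) : Prop :=
  (∀ s ∈ J, 0 ≤ deriv (deriv τ) s / τ s) ∧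
  ∃ (σ : ℝ → ℝ) (c₃ : ℝ), (∀ s ∈ J, σ s = 1 ∨ σ s = -1) ∧
    ContinuousOn (fun s => σ s * √(((m : ℝ) - 2) / θ * (deriv (deriv τ) s / τ s))) J ∧
    ∀ ζ ∈ J, u ζ =
      (∫ s in ζ₀..ζ, σ s * √(((m : ℝ) - 2) / θ * (deriv (deriv τ) s / τ s))) + c₃

/-- The fiber functions when `‖β‖² = 1`. -/
def FiberUnit (m : ℕ) (θ : ℝ) (J : Set ℝ) (τ u : ℝ → ℝ) : Prop :=
  ∃ c₁ c₂ c₃ σ : ℝ, 0 < c₂ ∧ (σ = 1 ∨ σ = -1) ∧ ∀ ζ ∈ J,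
    ((m : ℝ) - 2) * ζ + c₁ ≠ 0 ∧
    τ ζ = c₂ * |((m : ℝ) - 2) * ζ + c₁| ^ (1 / (2 - (m : ℝ))) ∧
    u ζ = c₃ + σ * (√(2 - 3 * (m : ℝ) + (m : ℝ) ^ 2) * (((m : ℝ) - 2) * ζ + c₁) *
      Real.log |((m : ℝ) - 2) * ζ + c₁| /
        (((m : ℝ) - 2) * √(θ * (((m : ℝ) - 2) * ζ + c₁) ^ 2)))

/-- The discriminant root `√(m + k²(n-1))`. -/
def rootD (n m : ℕ) (k : ℝ) : ℝ := √((m : ℝ) + k ^ 2 * ((n : ℝ) - 1))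

/-- The power law family with exponent constant `N = N₊` or `N = N₋`. -/
def BasePower (n m : ℕ) (k : ℝ) (I : Set ℝ) (φ f h : ℝ → ℝ) : Prop :=
  ∃ N c₄ c₅ c₇ b : ℝ, (N = -k + rootD n m k ∨ N = -k - rootD n m k) ∧ 0 < c₄ ∧ 0 < c₅ ∧
    ∀ ξ ∈ I, N * ξ + b ≠ 0 ∧
      φ ξ = c₄ / |N * ξ + b| ^ (k / N) ∧
      f ξ = c₅ / |N * ξ + b| ^ (1 / N) ∧
      h ξ = -(((m : ℝ) - ((n : ℝ) - 2) * k + N) / N) * Real.log |N * ξ + b| + c₇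

/-- The family obtained by integrating the system in the auxiliary function `z`. -/
def BaseSystem (n m : ℕ) (k : ℝ) (z : ℝ → ℝ) (I : Set ℝ) (φ f h : ℝ → ℝ) : Prop :=
  ∃ (a c₆ : ℝ) (ψ : ℝ → ℝ), a = k / rootD n m k ∧
    ∀ ξ ∈ I,
      deriv φ ξ / φ ξ = k * (deriv f ξ / f ξ) ∧
      deriv f ξ / f ξ = ψ ξ ∧
      deriv h ξ = (z ξ + m - k * ((n : ℝ) - 2)) * ψ ξ ∧
      z ξ + k - rootD n m k ≠ 0 ∧ z ξ + k + rootD n m k ≠ 0 ∧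
      ψ ξ = c₆ * |z ξ + k - rootD n m k| ^ ((a - 1) / 2)
        * |z ξ + k + rootD n m k| ^ ((-a - 1) / 2) ∧
      deriv z ξ = -c₆ * signedPow (z ξ + k - rootD n m k) ((a + 1) / 2)
        * signedPow (z ξ + k + rootD n m k) ((-a + 1) / 2)

/-- The base functions when `‖α‖² = 1`: there are a constant `k` and a smooth function `z` with
`φ'/φ = k f'/f` and `h' + [(n-2)k - m] f'/f = z f'/f`; if `z` is a nonzero constant the functions
are power laws, if `z` is not constant they are obtained from the system in `z`. -/
def BaseUnit (n m : ℕ) (I : Set ℝ) (φ f h : ℝ → ℝ) : Prop :=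
  ∃ (k : ℝ) (z : ℝ → ℝ), ContDiffOn ℝ ∞ z I ∧
    (∀ ξ ∈ I, deriv φ ξ / φ ξ = k * (deriv f ξ / f ξ) ∧
      deriv h ξ + (((n : ℝ) - 2) * k - m) * (deriv f ξ / f ξ) = z ξ * (deriv f ξ / f ξ)) ∧
    (((∃ z₀ : ℝ, z₀ ≠ 0 ∧ ∀ ξ ∈ I, z ξ = z₀) ∧ BasePower n m k I φ f h) ∨
      (NonConstOn z I ∧ BaseSystem n m k z I φ f h))

end RicciHarmonic

end

open RicciHarmonic

set_option linter.unusedSectionVars false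
set_option linter.unusedSimpArgs false

noncomputable section

/-! The metrics are diagonal and their entries depend on linear forms only, so the tensor equations
reduce to ordinary differential equations in `ξ` and `ζ`, which are then integrated.

Reduction. For a diagonal metric with entries `G k`, put `W k i = ½ ∂ᵢ log |G k|`; the Christoffel
symbols are linear in `W` up to ratios of entries, and `IsDiagonalOn.ricci_eq` gives the Ricci
tensor. On the base block and on the fiber alone, each equation reads `X v vᵀ + Y diag(signs) = 0`
with `v = α` or `v = β`, and `rank_one_add_diagonal_eq_zero` separates it into `X = 0` and `Y = 0`.
The mixed block vanishes identically, and the steady fiber removes the fiber curvature from the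
fiber block of the warped product. Hence (S) is equivalent to `BaseODE` in `ξ` together with
`FiberODE` in `ζ` (`isSteadyWithSteadyFiber_iff`), and base and fiber can be solved independently.
The squared norms multiply all but the first equation of each system.

Null norms. One equation survives in each system. On the fiber it prescribes `u'²`; on the base it
prescribes `(φ² h')'`, so `h` follows by two integrations.

Unit fiber. With `t = τ'/τ`, the system contains `t' = (m-2) t²` and `u'' = (m-2) t u'`. Thus `-1/t`
is affine, equal to `ℓ`, and `u' = K/ℓ`; the remaining equation fixes `θ K² = (m-1)(m-2)`.

Unit base. With `p = φ'/φ`, `q = f'/f` and `w = (n-2)p - m q + h'`, the system says `p' = w p` and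
`q' = w q`. As `f` is not constant, `q` has no zeros, so `p = k q` for a constant `k`. For `z = w/q`
one gets `q' = z q²`, and the first equation becomes `z' = -q (z+k-D)(z+k+D)`. By uniqueness for
linear equations, each factor vanishes identically or nowhere. If one vanishes, `z` is constant,
`-1/q` is affine and power laws result; otherwise `q` is a constant multiple of `|z+k-D|^((a-1)/2)
|z+k+D|^((-a-1)/2)`. -/

namespace RicciHarmonic

/-! ### Ricci tensor, Hessian and tension of a diagonal metric -/

section Diagonal

variable {ι : Type*} [Fintype ι] [DecidableEq ι]

theorem pd_congr {F G : (ι → ℝ) → ℝ} {x : ι → ℝ} (i : ι) (h : F =ᶠ[nhds x] G) :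
    pd i F x = pd i G x := by
  unfold pd; rw [h.fderiv_eq]

theorem HasFDerivAt.pd_eq {F : (ι → ℝ) → ℝ} {x : ι → ℝ} {L : (ι → ℝ) →L[ℝ] ℝ} (i : ι)
    (h : HasFDerivAt F L x) : pd i F x = L (Pi.single i 1) := by
  unfold pd; rw [h.fderiv]

theorem pd_const (i : ι) (c : ℝ) (x : ι → ℝ) : pd i (fun _ => c) x = 0 := by
  simp [pd]

theorem pd_add {F G : (ι → ℝ) → ℝ} {x : ι → ℝ} (i : ι) (hF : DifferentiableAt ℝ F x)
    (hG : DifferentiableAt ℝ G x) : pd i (fun y => F y + G y) x = pd i F x + pd i G x := by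
  rw [HasFDerivAt.pd_eq i (hF.hasFDerivAt.fun_add hG.hasFDerivAt)]; rfl

theorem pd_sub {F G : (ι → ℝ) → ℝ} {x : ι → ℝ} (i : ι) (hF : DifferentiableAt ℝ F x)
    (hG : DifferentiableAt ℝ G x) : pd i (fun y => F y - G y) x = pd i F x - pd i G x := by
  rw [HasFDerivAt.pd_eq i (hF.hasFDerivAt.fun_sub hG.hasFDerivAt)]; rfl

theorem pd_mul {F G : (ι → ℝ) → ℝ} {x : ι → ℝ} (i : ι) (hF : DifferentiableAt ℝ F x)
    (hG : DifferentiableAt ℝ G x) :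
    pd i (fun y => F y * G y) x = pd i F x * G x + F x * pd i G x := by
  rw [HasFDerivAt.pd_eq i (hF.hasFDerivAt.fun_mul hG.hasFDerivAt)]
  simp [pd]; ring

theorem pd_const_mul {F : (ι → ℝ) → ℝ} {x : ι → ℝ} (i : ι) (c : ℝ)
    (hF : DifferentiableAt ℝ F x) : pd i (fun y => c * F y) x = c * pd i F x := by
  rw [HasFDerivAt.pd_eq i (hF.hasFDerivAt.const_mul c)]; rfl

theorem differentiableAt_div {F G : (ι → ℝ) → ℝ} {x : ι → ℝ} (hF : DifferentiableAt ℝ F x)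
    (hG : DifferentiableAt ℝ G x) (h0 : G x ≠ 0) :
    DifferentiableAt ℝ (fun y => F y / G y) x := by
  simp only [div_eq_mul_inv]
  exact hF.fun_mul (hG.inv h0)

theorem pd_div {F G : (ι → ℝ) → ℝ} {x : ι → ℝ} (i : ι) (hF : DifferentiableAt ℝ F x)
    (hG : DifferentiableAt ℝ G x) (h0 : G x ≠ 0) :
    pd i (fun y => F y / G y) x = (pd i F x * G x - F x * pd i G x) / G x ^ 2 := by
  have h1 : pd i (fun y => (G y)⁻¹) x = -pd i G x / G x ^ 2 := by
    have h2 : HasFDerivAt (fun y => (G y)⁻¹) _ x :=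
      (hasDerivAt_inv h0).comp_hasFDerivAt x hG.hasFDerivAt
    rw [HasFDerivAt.pd_eq i h2]
    simp [pd]
    field_simp
  simp only [div_eq_mul_inv (F _)]
  have h3 : DifferentiableAt ℝ (fun y => (G y)⁻¹) x := hG.inv h0
  rw [pd_mul i hF h3, h1]
  field_simp
  ring

/-- On the open set `U` the metric `g` is diagonal with entries `G k`, whose logarithmic
derivatives are `∂ᵢ G k = 2 G k W k i`, and `W2 k i j = ∂ⱼ W k i`. -/
structure IsDiagonalOn (U : Set (ι → ℝ)) (g : (ι → ℝ) → Matrix ι ι ℝ) (G : ι → (ι → ℝ) → ℝ)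
    (W : ι → ι → (ι → ℝ) → ℝ) (W2 : ι → ι → ι → (ι → ℝ) → ℝ) : Prop where
  isOpen : IsOpen U
  eq_diagonal : ∀ x, g x = Matrix.diagonal fun k => G k x
  ne_zero : ∀ x ∈ U, ∀ k, G k x ≠ 0
  differentiableAt : ∀ x ∈ U, ∀ k, DifferentiableAt ℝ (G k) x
  pd_eq : ∀ x ∈ U, ∀ k i, pd i (G k) x = 2 * G k x * W k i x
  differentiableAt_log : ∀ x ∈ U, ∀ k i, DifferentiableAt ℝ (W k i) x
  pd_log : ∀ x ∈ U, ∀ k i j, pd j (W k i) x = W2 k i j x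
  symm : ∀ k i j, W2 k i j = W2 k j i

namespace IsDiagonalOn

variable {U : Set (ι → ℝ)} {g : (ι → ℝ) → Matrix ι ι ℝ} {G : ι → (ι → ℝ) → ℝ}
  {W : ι → ι → (ι → ℝ) → ℝ} {W2 : ι → ι → ι → (ι → ℝ) → ℝ}

theorem inv_eq (H : IsDiagonalOn U g G W W2) {x : ι → ℝ} (hx : x ∈ U) :
    (g x)⁻¹ = Matrix.diagonal fun k => (G k x)⁻¹ := by
  rw [H.eq_diagonal]
  apply Matrix.inv_eq_right_inv
  rw [Matrix.diagonal_mul_diagonal, ← Matrix.diagonal_one]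
  congr 1; funext k
  exact mul_inv_cancel₀ (H.ne_zero x hx k)

theorem pd_entry (H : IsDiagonalOn U g G W W2) {x : ι → ℝ} (hx : x ∈ U) (i j l : ι) :
    pd i (fun y => g y j l) x = (if j = l then 1 else 0) * (2 * G j x * W j i x) := by
  simp only [H.eq_diagonal, Matrix.diagonal_apply]
  split_ifs with h
  · rw [one_mul, ← H.pd_eq x hx]
  · rw [pd_const, zero_mul]

theorem christoffel_eq (H : IsDiagonalOn U g G W W2) {x : ι → ℝ} (hx : x ∈ U) (k i j : ι) :
    christoffel g k i j x = (if j = k then 1 else 0) * W k i x + (if i = k then 1 else 0) * W k j x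
      - (if i = j then 1 else 0) * (G i x / G k x * W i k x) := by
  have h0 := H.ne_zero x hx k
  unfold christoffel
  rw [H.inv_eq hx]
  simp only [Matrix.diagonal_apply, ite_mul, zero_mul, Finset.sum_ite_eq, Finset.mem_univ, if_true,
    H.pd_entry hx]
  split_ifs <;> subst_vars <;> first | (exact absurd rfl ‹_›) | (field_simp <;> ring)

theorem pd_ratio (H : IsDiagonalOn U g G W W2) {x : ι → ℝ} (hx : x ∈ U) (i k l : ι) :
    pd l (fun y => G i y / G k y * W i k y) x =
      G i x / G k x * (2 * (W i l x - W k l x) * W i k x + W2 i k l x) := by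
  have h0 := H.ne_zero x hx k
  have d1 := H.differentiableAt x hx i
  have d2 := H.differentiableAt x hx k
  rw [pd_mul l (differentiableAt_div d1 d2 h0) (H.differentiableAt_log x hx i k), pd_div l d1 d2 h0,
    H.pd_log x hx, H.pd_eq x hx, H.pd_eq x hx]
  field_simp

theorem pd_christoffel (H : IsDiagonalOn U g G W W2) {x : ι → ℝ} (hx : x ∈ U) (k i j l : ι) :
    pd l (christoffel g k i j) x = (if j = k then 1 else 0) * W2 k i l x
      + (if i = k then 1 else 0) * W2 k j l x
      - (if i = j then 1 else 0) *
        (G i x / G k x * (2 * (W i l x - W k l x) * W i k x + W2 i k l x)) := by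
  have d1 := H.differentiableAt_log x hx k i
  have d2 := H.differentiableAt_log x hx k j
  have d3 : DifferentiableAt ℝ (fun y => G i y / G k y * W i k y) x :=
    (differentiableAt_div (H.differentiableAt x hx i) (H.differentiableAt x hx k)
      (H.ne_zero x hx k)).fun_mul (H.differentiableAt_log x hx i k)
  rw [pd_congr l (Filter.eventuallyEq_of_mem (H.isOpen.mem_nhds hx)
    fun y hy => H.christoffel_eq hy k i j),
    pd_sub l ((d1.const_mul _).fun_add (d2.const_mul _)) (d3.const_mul _),
    pd_add l (d1.const_mul _) (d2.const_mul _), pd_const_mul l _ d1, pd_const_mul l _ d2,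
    pd_const_mul l _ d3, H.pd_ratio hx, H.pd_log x hx, H.pd_log x hx]

/-- Each Christoffel symbol is a sum of three Kronecker deltas times entries of `W`, and the
contraction `Γᵏₖₗ` is just `W k l`. Summing the derivative part (`e1`) and the two quadratic parts
(`e2`, `e3`) therefore collapses every index constrained by a delta. Logarithmic derivatives keep
the result polynomial in `W` and `W2` apart from the ratios `G i / G k`. -/
theorem ricci_eq (H : IsDiagonalOn U g G W W2) {x : ι → ℝ} (hx : x ∈ U) (i j : ι) :
    ricci g i j x = W2 j i j x + W2 i i j x - ∑ k, W2 k i j x - ∑ k, W k i x * W k j x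
      + (∑ k, W k i x) * W i j x + (∑ k, W k j x) * W j i x - 2 * (W i j x * W j i x)
      - (if i = j then 1 else 0) * ∑ k, G i x / G k x *
        (W2 i k k x - 2 * W k k x * W i k x + (∑ l, W l k x) * W i k x) := by
  have hI := H.ne_zero x hx i
  have hJ := H.ne_zero x hx j
  have key1 : ∀ k l, christoffel g k k l x = W k l x := by
    intro k l
    rw [H.christoffel_eq hx]
    by_cases h : l = k
    · subst h; simp; field_simp [H.ne_zero x hx l]; ring
    · have : k ≠ l := fun e => h e.symm
      simp [h, this]
  have key2 : ∀ k, christoffel g k i k x = W k i x := by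
    intro k
    rw [H.christoffel_eq hx]
    by_cases h : i = k
    · subst h; simp; field_simp; ring
    · simp [h]
  have e1 : ∑ k, (pd k (christoffel g k i j) x - pd j (christoffel g k i k) x) =
      W2 j i j x + W2 i j i x
      - (if i = j then 1 else 0) * (∑ k, G i x / G k x *
          (2 * (W i k x - W k k x) * W i k x + W2 i k k x)) - ∑ k, W2 k i j x := by
    have : ∀ k, pd j (christoffel g k i k) x = W2 k i j x := by
      intro k
      rw [H.pd_christoffel hx]
      by_cases h : i = k
      · subst h; simp; field_simp; ring
      · simp [h]
    simp only [this, H.pd_christoffel hx, Finset.sum_sub_distrib, Finset.sum_add_distrib, ite_mul,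
      one_mul, zero_mul, Finset.sum_ite_eq, Finset.mem_univ, if_true]
    congr 2
    split_ifs <;> simp
  have e2 : ∑ k, ∑ l, christoffel g k k l x * christoffel g l i j x =
      (∑ k, W k i x) * W i j x + (∑ k, W k j x) * W j i x
      - (if i = j then 1 else 0) * ∑ k, G i x / G k x * ((∑ l, W l k x) * W i k x) := by
    -- With the sums exchanged, the trace `Γᵏₖₗ` is summed over `k` before the remaining factor is
    -- expanded.
    rw [Finset.sum_comm]
    simp only [key1, ← Finset.sum_mul]
    simp only [H.christoffel_eq hx, mul_add, mul_sub, Finset.sum_sub_distrib,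
      Finset.sum_add_distrib, ite_mul, mul_ite, one_mul, zero_mul, mul_zero, Finset.sum_ite_eq,
      Finset.mem_univ, if_true]
    split_ifs with h
    · subst h
      congr 1
      exact Finset.sum_congr rfl fun k _ => by ring
    · simp; ring
  have e3 : ∑ k, ∑ l, christoffel g k j l x * christoffel g l i k x =
      ∑ k, W k i x * W k j x + 2 * (W i j x * W j i x)
      - (if i = j then 1 else 0) * (2 * ∑ k, G i x / G k x * (W i k x * W i k x)) := by
    -- Only the first factor is expanded here: its three deltas leave a contraction with `l = k`, a
    -- full sum when `j = k`, and a term with `l = j`. The last two are evaluated in `f2` and `f3`.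
    have f1 : ∀ k, ∑ l, christoffel g k j l x * christoffel g l i k x = W k i x * W k j x
        + (if j = k then 1 else 0) * ∑ l, W k l x * christoffel g l i k x
        - G j x / G k x * W j k x * christoffel g j i k x := by
      intro k
      have : ∀ l, christoffel g k j l x * christoffel g l i k x =
          (if l = k then W k j x * christoffel g k i k x else 0)
          + (if j = k then 1 else 0) * (W k l x * christoffel g l i k x)
          - (if j = l then G j x / G k x * W j k x * christoffel g j i k x else 0) := by
        intro l
        rw [H.christoffel_eq hx k j l]
        split_ifs <;> subst_vars <;> ring
      simp only [this, Finset.sum_sub_distrib, Finset.sum_add_distrib, Finset.sum_ite_eq,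
        Finset.sum_ite_eq', Finset.mem_univ, if_true, ← Finset.mul_sum]
      rw [key2]; ring
    have f2 : ∑ l, W j l x * christoffel g l i j x = W j j x * W j i x + W j i x * W i j x
        - (if i = j then 1 else 0) * ∑ l, G i x / G l x * (W i l x * W i l x) := by
      simp only [H.christoffel_eq hx, mul_add, mul_sub, Finset.sum_sub_distrib,
        Finset.sum_add_distrib, ite_mul, mul_ite, one_mul, zero_mul, mul_zero, Finset.sum_ite_eq,
        Finset.mem_univ, if_true]
      split_ifs with h
      · subst h
        congr 1
        exact Finset.sum_congr rfl fun k _ => by ring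
      · simp
    have f3 : ∑ k, G j x / G k x * W j k x * christoffel g j i k x = W j j x * W j i x
        + (if i = j then 1 else 0) * (∑ k, G i x / G k x * (W i k x * W i k x))
        - W j i x * W i j x := by
      simp only [H.christoffel_eq hx, mul_add, mul_sub, Finset.sum_sub_distrib,
        Finset.sum_add_distrib, ite_mul, mul_ite, one_mul, zero_mul, mul_zero, Finset.sum_ite_eq,
        Finset.sum_ite_eq', Finset.mem_univ, if_true]
      split_ifs with h
      · subst h
        simp only [mul_assoc]
        field_simp
      · simp
        field_simp
    simp only [f1, Finset.sum_sub_distrib, Finset.sum_add_distrib, ite_mul, one_mul, zero_mul,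
      Finset.sum_ite_eq, Finset.mem_univ, if_true, f2, f3]
    split_ifs <;> ring
  unfold ricci
  simp only [Finset.sum_sub_distrib] at e1 ⊢
  rw [e1, e2, e3, H.symm i j i]
  split_ifs with h
  · simp only [one_mul]
    have hs : ∑ k, G i x / G k x *
          (W2 i k k x - 2 * W k k x * W i k x + (∑ l, W l k x) * W i k x) =
        ∑ k, G i x / G k x * (2 * (W i k x - W k k x) * W i k x + W2 i k k x)
        + ∑ k, G i x / G k x * ((∑ l, W l k x) * W i k x)
        - 2 * ∑ k, G i x / G k x * (W i k x * W i k x) := by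
      rw [Finset.mul_sum, ← Finset.sum_add_distrib, ← Finset.sum_sub_distrib]
      exact Finset.sum_congr rfl fun k _ => by ring
    rw [hs]; ring
  · ring

theorem hess_eq (H : IsDiagonalOn U g G W W2) (F : (ι → ℝ) → ℝ) {x : ι → ℝ} (hx : x ∈ U)
    (i j : ι) :
    hess g F i j x = pd i (pd j F) x - W j i x * pd j F x - W i j x * pd i F x
      + (if i = j then 1 else 0) * ∑ k, G i x / G k x * (W i k x * pd k F x) := by
  unfold hess
  simp only [H.christoffel_eq hx, add_mul, sub_mul, Finset.sum_sub_distrib,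
      Finset.sum_add_distrib, ite_mul, one_mul, zero_mul, Finset.sum_ite_eq, Finset.mem_univ,
      if_true]
  split_ifs
  · simp only [mul_assoc]; ring
  · simp; ring

theorem tension_eq (H : IsDiagonalOn U g G W W2) (F : (ι → ℝ) → ℝ) {x : ι → ℝ} (hx : x ∈ U) :
    tension g F x = ∑ i, (G i x)⁻¹ * hess g F i i x := by
  unfold tension
  rw [H.inv_eq hx]
  simp [Matrix.diagonal_apply]

theorem gradInner_eq (H : IsDiagonalOn U g G W W2) (F K : (ι → ℝ) → ℝ) {x : ι → ℝ} (hx : x ∈ U) :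
    gradInner g F K x = ∑ i, (G i x)⁻¹ * pd i F x * pd i K x := by
  unfold gradInner
  rw [H.inv_eq hx]
  simp [Matrix.diagonal_apply]

end IsDiagonalOn

end Diagonal

/-! ### Functions of a linear form -/

section LinearFunctions

variable {ι : Type*} [Fintype ι] [DecidableEq ι]

theorem hasFDerivAt_lin (a x : ι → ℝ) :
    HasFDerivAt (lin a) (∑ i, a i • ContinuousLinearMap.proj (R := ℝ) (φ := fun _ : ι => ℝ) i) x := by
  have : lin a = ⇑(∑ i, a i • ContinuousLinearMap.proj (R := ℝ) (φ := fun _ : ι => ℝ) i) := by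
    funext y; simp [lin]
  rw [this]
  exact ContinuousLinearMap.hasFDerivAt _

theorem contDiff_lin (a : ι → ℝ) : ContDiff ℝ ∞ (lin a) := by
  unfold lin; fun_prop

theorem hasFDerivAt_comp_lin {F : ℝ → ℝ} {F' : ℝ} {a x : ι → ℝ} (h : HasDerivAt F F' (lin a x)) :
    HasFDerivAt (fun y => F (lin a y))
      (F' • ∑ i, a i • ContinuousLinearMap.proj (R := ℝ) (φ := fun _ : ι => ℝ) i) x :=
  h.comp_hasFDerivAt x (hasFDerivAt_lin a x)

theorem pd_comp_lin {F : ℝ → ℝ} {F' : ℝ} {a x : ι → ℝ} (i : ι) (h : HasDerivAt F F' (lin a x)) :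
    pd i (fun y => F (lin a y)) x = F' * a i := by
  rw [HasFDerivAt.pd_eq i (hasFDerivAt_comp_lin h)]
  simp [Pi.single_apply]

theorem differentiableAt_comp_lin {F : ℝ → ℝ} {F' : ℝ} {a x : ι → ℝ}
    (h : HasDerivAt F F' (lin a x)) : DifferentiableAt ℝ (fun y => F (lin a y)) x :=
  (hasFDerivAt_comp_lin h).differentiableAt

/-- Surjectivity of a nonzero form lets identities at points of the domain be read as differential
equations on the whole interval. -/
theorem exists_lin_eq {a : ι → ℝ} (ha : a ≠ 0) (s : ℝ) : ∃ x, lin a x = s := by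
  obtain ⟨i, hi⟩ := Function.ne_iff.1 ha
  refine ⟨Pi.single i (s / a i), ?_⟩
  simp only [lin, Pi.single_apply, mul_ite, mul_zero, Finset.sum_ite_eq', Finset.mem_univ, if_true]
  field_simp [show a i ≠ 0 from hi]

/-- Extending the coefficients by zero turns `ξ` and `ζ` into linear forms on the product, so the
same chain rules serve base and fiber. -/
theorem lin_inl {κ : Type*} [Fintype κ] (a : ι → ℝ) (x : ι ⊕ κ → ℝ) :
    lin a (x ∘ Sum.inl) = lin (Sum.elim a 0) x := by
  simp [lin]

theorem lin_inr {κ : Type*} [Fintype κ] (a : κ → ℝ) (x : ι ⊕ κ → ℝ) :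
    lin a (x ∘ Sum.inr) = lin (Sum.elim 0 a) x := by
  simp [lin]

theorem isOpen_lin_mem {J : Set ℝ} (hJ : IsOpen J) (a : ι → ℝ) : IsOpen {x | lin a x ∈ J} :=
  hJ.preimage (contDiff_lin a).continuous

theorem contDiffOn_comp_lin {F : ℝ → ℝ} {J : Set ℝ} (hF : ContDiffOn ℝ ∞ F J) (a : ι → ℝ)
    {U : Set (ι → ℝ)} (hU : ∀ x ∈ U, lin a x ∈ J) : ContDiffOn ℝ ∞ (fun x => F (lin a x)) U :=
  hF.comp (contDiff_lin a).contDiffOn hU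

/-- A combination of `v vᵀ` and a diagonal matrix of signs vanishes only trivially. -/
theorem rank_one_add_diagonal_eq_zero [Nontrivial ι] {s v : ι → ℝ} (hs : ∀ i, s i = 1 ∨ s i = -1)
    (hv : v ≠ 0) {X Y : ℝ}
    (h : ∀ i j, X * (v i * v j) + (if i = j then 1 else 0) * (s i * Y) = 0) : X = 0 ∧ Y = 0 := by
  obtain ⟨i, hi⟩ := Function.ne_iff.1 hv
  have hi : v i ≠ 0 := hi
  -- The `(i, j)` entry gives `X = 0` or `v j = 0`. In the first case the `(i, i)` entry gives `Y =
  -- 0`; in the second the `(j, j)` entry gives `Y = 0`, and then the `(i, i)` entry gives `X = 0`.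
  obtain ⟨j, hj⟩ := exists_ne i
  have h1 := h i j
  have h2 := h j j
  have h3 := h i i
  have hsi : s i ≠ 0 := by rcases hs i with e | e <;> rw [e] <;> norm_num
  have hsj : s j ≠ 0 := by rcases hs j with e | e <;> rw [e] <;> norm_num
  simp [hj.symm, hi] at h1 h2 h3
  rcases h1 with h1 | h1
  · subst h1; simpa [hsi] using h3
  · simp [h1, hsj] at h2
    subst h2
    simpa [hi] using h3

end LinearFunctions

/-! ### Logarithmic derivatives of smooth functions -/

section Smooth

variable {I : Set ℝ} {F : ℝ → ℝ}

theorem hasDerivAt_of_smooth (hI : IsOpen I) (hF : ContDiffOn ℝ ∞ F I) {s : ℝ} (hs : s ∈ I) :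
    HasDerivAt F (deriv F s) s :=
  ((hF.differentiableOn (by simp)).differentiableAt (hI.mem_nhds hs)).hasDerivAt

theorem smooth_deriv (hI : IsOpen I) (hF : ContDiffOn ℝ ∞ F I) : ContDiffOn ℝ ∞ (deriv F) I :=
  hF.deriv_of_isOpen hI (by simp)

theorem smooth_logDeriv (hI : IsOpen I) (hF : ContDiffOn ℝ ∞ F I) (h0 : ∀ s ∈ I, 0 < F s) :
    ContDiffOn ℝ ∞ (logDeriv F) I :=
  (smooth_deriv hI hF).div hF fun s hs => (h0 s hs).ne'

/-- Translates between the second-order quotients in the explicit formulas and the logarithmic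
derivatives used in the curvature computation. -/
theorem deriv_deriv_div (hI : IsOpen I) (hF : ContDiffOn ℝ ∞ F I) (h0 : ∀ s ∈ I, 0 < F s)
    {s : ℝ} (hs : s ∈ I) :
    deriv (deriv F) s / F s = deriv (logDeriv F) s + logDeriv F s ^ 2 := by
  have h1 := (hasDerivAt_of_smooth hI (smooth_deriv hI hF) hs).div
    (hasDerivAt_of_smooth hI hF hs) (h0 s hs).ne'
  have h2 : deriv (logDeriv F) s = _ := h1.deriv
  have := (h0 s hs).ne'
  rw [h2, logDeriv_apply]
  field_simp
  ring

end Smooth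

section Sums

variable {n : ℕ}

theorem sum_sign_mul_sq {ε : Fin n → ℝ} (hε : ∀ i, ε i = 1 ∨ ε i = -1) (α : Fin n → ℝ)
    (c : ℝ) : ∑ k, (c / ε k) * (α k * α k) = c * sqNorm ε α := by
  rw [sqNorm, Finset.mul_sum]
  refine Finset.sum_congr rfl fun k _ => ?_
  rcases hε k with e | e <;> rw [e] <;> ring

end Sums

/-! ### The conformally flat fiber and its differential equations -/

section Fiber

variable {m : ℕ} {δ : Fin m → ℝ} {J : Set ℝ} {τ : ℝ → ℝ}

theorem sign_ne_zero' {δ : Fin m → ℝ} (hδ : ∀ j, δ j = 1 ∨ δ j = -1) (j : Fin m) : δ j ≠ 0 := by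
  rcases hδ j with e | e <;> rw [e] <;> norm_num

theorem isDiagonalOn_conformal (hδ : ∀ j, δ j = 1 ∨ δ j = -1) (β : Fin m → ℝ) (hJ : IsOpen J)
    (hτ : ContDiffOn ℝ ∞ τ J) (hτ0 : ∀ ζ ∈ J, 0 < τ ζ) :
    IsDiagonalOn {q : Fin m → ℝ | lin β q ∈ J} (conformalMetric δ fun q => τ (lin β q))
      (fun k q => δ k / τ (lin β q) ^ 2) (fun _ i q => -(logDeriv τ (lin β q) * β i))
      (fun _ i j q => -(deriv (logDeriv τ) (lin β q) * (β i * β j))) where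
  isOpen := isOpen_lin_mem hJ β
  eq_diagonal _ := rfl
  ne_zero x hx k := div_ne_zero (sign_ne_zero' hδ k) (pow_ne_zero _ (hτ0 _ hx).ne')
  differentiableAt x hx k := differentiableAt_comp_lin (F := fun s => δ k / τ s ^ 2)
    ((((hasDerivAt_of_smooth hJ hτ hx).fun_pow 2).inv
      (pow_ne_zero _ (hτ0 _ hx).ne')).const_mul (δ k))
  pd_eq x hx k i := by
    have h0 := (hτ0 _ hx).ne'
    rw [pd_comp_lin (F := fun s => δ k / τ s ^ 2) i
      ((((hasDerivAt_of_smooth hJ hτ hx).fun_pow 2).inv (pow_ne_zero _ h0)).const_mul (δ k)),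
      logDeriv_apply]
    field_simp
    simp
    ring
  differentiableAt_log x hx k i := by
    have := hasDerivAt_of_smooth hJ (smooth_logDeriv hJ hτ hτ0) hx
    exact differentiableAt_comp_lin (F := fun s => -(logDeriv τ s * β i)) (this.mul_const _).neg
  pd_log x hx k i j := by
    have := hasDerivAt_of_smooth hJ (smooth_logDeriv hJ hτ hτ0) hx
    rw [pd_comp_lin (F := fun s => -(logDeriv τ s * β i)) j (this.mul_const _).neg]
    ring
  symm k i j := by funext q; ring

/-- All entries share the same logarithmic derivative, so the sums over `k` become multiples of `m`
or, in the diagonal term, of `‖β‖²`. What is left is a rank-one part along `β βᵀ` plus a multiple of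
the signature matrix. -/
theorem ricci_conformal (hδ : ∀ j, δ j = 1 ∨ δ j = -1) (β : Fin m → ℝ) (hJ : IsOpen J)
    (hτ : ContDiffOn ℝ ∞ τ J) (hτ0 : ∀ ζ ∈ J, 0 < τ ζ) {x : Fin m → ℝ} (hx : lin β x ∈ J)
    (i j : Fin m) :
    ricci (conformalMetric δ fun q => τ (lin β q)) i j x =
      ((m : ℝ) - 2) * (deriv (logDeriv τ) (lin β x) + logDeriv τ (lin β x) ^ 2) * (β i * β j)
      + (if i = j then 1 else 0) * (δ i * (sqNorm δ β *
        (deriv (logDeriv τ) (lin β x) - ((m : ℝ) - 2) * logDeriv τ (lin β x) ^ 2))) := by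
  rw [(isDiagonalOn_conformal hδ β hJ hτ hτ0).ricci_eq hx]
  have h0 := (hτ0 _ hx).ne'
  set t := logDeriv τ (lin β x)
  set t' := deriv (logDeriv τ) (lin β x)
  simp only [Finset.sum_const, Finset.card_univ, Fintype.card_fin, nsmul_eq_mul]
  have : ∀ k, δ i / τ (lin β x) ^ 2 / (δ k / τ (lin β x) ^ 2) *
      (-(t' * (β k * β k)) - 2 * -(t * β k) * -(t * β k) + m * -(t * β k) * -(t * β k)) =
      (-t' - 2 * t ^ 2 + m * t ^ 2) * (δ i / δ k * (β k * β k)) := by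
    intro k
    have := sign_ne_zero' hδ k
    field_simp
  simp only [this, ← Finset.mul_sum, sum_sign_mul_sq hδ]
  ring

theorem pd_pd_comp_lin {ι : Type*} [Fintype ι] [DecidableEq ι] {F : ℝ → ℝ} (hJ : IsOpen J)
    (hF : ContDiffOn ℝ ∞ F J) {a x : ι → ℝ} (hx : lin a x ∈ J) (i j : ι) :
    pd i (pd j fun y => F (lin a y)) x = deriv (deriv F) (lin a x) * (a i * a j) := by
  have : pd j (fun y => F (lin a y)) =ᶠ[nhds x] fun y => deriv F (lin a y) * a j :=
    Filter.eventuallyEq_of_mem ((isOpen_lin_mem hJ a).mem_nhds hx) fun y hy =>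
      pd_comp_lin j (hasDerivAt_of_smooth hJ hF hy)
  rw [pd_congr i this, pd_comp_lin (F := fun s => deriv F s * a j) i
    ((hasDerivAt_of_smooth hJ (smooth_deriv hJ hF) hx).mul_const _)]
  ring

theorem tension_conformal (hδ : ∀ j, δ j = 1 ∨ δ j = -1) (β : Fin m → ℝ) (hJ : IsOpen J)
    (hτ : ContDiffOn ℝ ∞ τ J) (hτ0 : ∀ ζ ∈ J, 0 < τ ζ) {u : ℝ → ℝ} (hu : ContDiffOn ℝ ∞ u J)
    {x : Fin m → ℝ} (hx : lin β x ∈ J) :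
    tension (conformalMetric δ fun q => τ (lin β q)) (fun q => u (lin β q)) x =
      τ (lin β x) ^ 2 * (sqNorm δ β *
        (deriv (deriv u) (lin β x) - ((m : ℝ) - 2) * logDeriv τ (lin β x) * deriv u (lin β x))) := by
  have H := isDiagonalOn_conformal hδ β hJ hτ hτ0
  have h0 := (hτ0 _ hx).ne'
  rw [H.tension_eq _ hx]
  simp only [H.hess_eq _ hx, pd_pd_comp_lin hJ hu hx, if_true,
    pd_comp_lin _ (hasDerivAt_of_smooth hJ hu hx)]
  set t := logDeriv τ (lin β x)
  set u' := deriv u (lin β x)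
  set u'' := deriv (deriv u) (lin β x)
  have h1 : ∀ i, ∑ k, δ i / τ (lin β x) ^ 2 / (δ k / τ (lin β x) ^ 2) *
      (-(t * β k) * (u' * β k)) = - t * u' * (δ i * sqNorm δ β) := by
    intro i
    rw [← sum_sign_mul_sq hδ, Finset.mul_sum]
    refine Finset.sum_congr rfl fun k _ => ?_
    have := sign_ne_zero' hδ k
    field_simp
  simp only [h1]
  have h2 : ∀ i, (δ i / τ (lin β x) ^ 2)⁻¹ * (u'' * (β i * β i) - -(t * β i) * (u' * β i)
      - -(t * β i) * (u' * β i) + 1 * (-t * u' * (δ i * sqNorm δ β))) =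
      τ (lin β x) ^ 2 * (u'' + 2 * t * u') * (1 / δ i * (β i * β i))
      - τ (lin β x) ^ 2 * t * u' * sqNorm δ β := by
    intro i
    have := sign_ne_zero' hδ i
    field_simp
    ring
  simp only [h2, Finset.sum_sub_distrib, ← Finset.mul_sum, sum_sign_mul_sq hδ, Finset.sum_const,
    Finset.card_univ, Fintype.card_fin, nsmul_eq_mul]
  ring

theorem isMetricOn_conformal (hδ : ∀ j, δ j = 1 ∨ δ j = -1) (β : Fin m → ℝ) (hJ : IsOpen J)
    (hτ : ContDiffOn ℝ ∞ τ J) (hτ0 : ∀ ζ ∈ J, 0 < τ ζ) :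
    IsMetricOn {q : Fin m → ℝ | lin β q ∈ J} (conformalMetric δ fun q => τ (lin β q)) where
  isOpen := isOpen_lin_mem hJ β
  smooth i j := by
    by_cases h : i = j
    · subst h
      simp only [conformalMetric, Matrix.diagonal_apply_eq]
      exact contDiffOn_const.div ((contDiffOn_comp_lin hτ β fun _ h => h).pow 2)
        fun x hx => pow_ne_zero _ (hτ0 _ hx).ne'
    · simp only [conformalMetric, Matrix.diagonal_apply_ne _ h]
      exact contDiffOn_const
  symm x _ := Matrix.isSymm_diagonal _
  nondegenerate x hx := by
    rw [conformalMetric, Matrix.det_diagonal]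
    exact Finset.prod_ne_zero_iff.2 fun i _ =>
      div_ne_zero (sign_ne_zero' hδ i) (pow_ne_zero _ (hτ0 _ hx).ne')

/-- The ordinary differential equations of a steady harmonic-Einstein fiber. -/
def FiberODE (m : ℕ) (θ N : ℝ) (J : Set ℝ) (τ u : ℝ → ℝ) : Prop :=
  ∀ ζ ∈ J, ((m : ℝ) - 2) * (deriv (logDeriv τ) ζ + logDeriv τ ζ ^ 2) = θ * deriv u ζ ^ 2 ∧
    N * (deriv (logDeriv τ) ζ - ((m : ℝ) - 2) * logDeriv τ ζ ^ 2) = 0 ∧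
    N * (deriv (deriv u) ζ - ((m : ℝ) - 2) * logDeriv τ ζ * deriv u ζ) = 0

/-- The term `θ du ⊗ du` is also a multiple of `β βᵀ`, so it enters only the rank-one equation; the
signature part gives the second equation, and the tension, up to the factor `τ²`, gives the third.
-/
theorem isHarmonicEinstein_iff (hm : 3 ≤ m) (hδ : ∀ j, δ j = 1 ∨ δ j = -1) {β : Fin m → ℝ}
    (hβ : β ≠ 0) {θ : ℝ} (hθ : 0 < θ) (hJ : IsOpen J) (hτ : ContDiffOn ℝ ∞ τ J)
    (hτ0 : ∀ ζ ∈ J, 0 < τ ζ) {u : ℝ → ℝ} (hu : ContDiffOn ℝ ∞ u J) :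
    IsHarmonicEinstein {q : Fin m → ℝ | lin β q ∈ J} (conformalMetric δ fun q => τ (lin β q))
      (fun q => u (lin β q)) θ 0 ↔ FiberODE m θ (sqNorm δ β) J τ u := by
  have : Nontrivial (Fin m) := Fin.nontrivial_iff_two_le.2 (by omega)
  constructor
  · intro H ζ hζ
    obtain ⟨x, rfl⟩ := exists_lin_eq hβ ζ
    have h1 := H.einstein x hζ
    have h2 := H.harmonic x hζ
    simp only [ricci_conformal hδ β hJ hτ hτ0 hζ, pd_comp_lin _ (hasDerivAt_of_smooth hJ hu hζ),
      zero_mul] at h1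
    rw [tension_conformal hδ β hJ hτ hτ0 hu hζ] at h2
    obtain ⟨h3, h4⟩ := rank_one_add_diagonal_eq_zero hδ hβ
      (X := ((m : ℝ) - 2) * (deriv (logDeriv τ) (lin β x) + logDeriv τ (lin β x) ^ 2)
        - θ * deriv u (lin β x) ^ 2)
      (Y := sqNorm δ β * (deriv (logDeriv τ) (lin β x)
        - ((m : ℝ) - 2) * logDeriv τ (lin β x) ^ 2)) fun i j => by
      linear_combination h1 i j
    exact ⟨sub_eq_zero.1 h3, h4,
      (mul_eq_zero.1 h2).resolve_left (pow_ne_zero _ (hτ0 _ hζ).ne')⟩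
  · intro H
    refine ⟨isMetricOn_conformal hδ β hJ hτ hτ0, contDiffOn_comp_lin hu β fun _ h => h, hθ.le, ?_,
      ?_⟩
    · intro x hx i j
      obtain ⟨h1, h2, -⟩ := H _ hx
      simp only [ricci_conformal hδ β hJ hτ hτ0 hx, pd_comp_lin _ (hasDerivAt_of_smooth hJ hu hx)]
      rw [h1, h2]; ring
    · intro x hx
      obtain ⟨-, -, h3⟩ := H _ hx
      rw [tension_conformal hδ β hJ hτ hτ0 hu hx, h3, mul_zero]

end Fiber

/-! ### The warped product and its reduction to differential equations -/

section Warped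

variable {n m : ℕ}

/-- The diagonal entries of the warped product of two conformally flat metrics. -/
def warpedEntry (ε α : Fin n → ℝ) (δ β : Fin m → ℝ) (φ f τ : ℝ → ℝ) (k : Fin n ⊕ Fin m)
    (x : Fin n ⊕ Fin m → ℝ) : ℝ :=
  Sum.elim (fun i => ε i / φ (lin (Sum.elim α 0) x) ^ 2)
    (fun j => f (lin (Sum.elim α 0) x) ^ 2 * (δ j / τ (lin (Sum.elim 0 β) x) ^ 2)) k

/-- Half the logarithmic partial derivatives of `warpedEntry`. -/
def warpedLog (α : Fin n → ℝ) (β : Fin m → ℝ) (φ f τ : ℝ → ℝ) (k i : Fin n ⊕ Fin m)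
    (x : Fin n ⊕ Fin m → ℝ) : ℝ :=
  let A : Fin n ⊕ Fin m → ℝ := Sum.elim α 0
  let B : Fin n ⊕ Fin m → ℝ := Sum.elim 0 β
  Sum.elim (fun _ => -(logDeriv φ (lin A x) * A i))
    (fun _ => logDeriv f (lin A x) * A i - logDeriv τ (lin B x) * B i) k

/-- The partial derivatives of `warpedLog`. -/
def warpedLog₂ (α : Fin n → ℝ) (β : Fin m → ℝ) (φ f τ : ℝ → ℝ) (k i j : Fin n ⊕ Fin m)
    (x : Fin n ⊕ Fin m → ℝ) : ℝ :=
  let A : Fin n ⊕ Fin m → ℝ := Sum.elim α 0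
  let B : Fin n ⊕ Fin m → ℝ := Sum.elim 0 β
  Sum.elim (fun _ => -(deriv (logDeriv φ) (lin A x) * (A i * A j)))
    (fun _ => deriv (logDeriv f) (lin A x) * (A i * A j) -
      deriv (logDeriv τ) (lin B x) * (B i * B j)) k

variable {ε α : Fin n → ℝ} {δ β : Fin m → ℝ} {I J : Set ℝ} {φ f τ h u : ℝ → ℝ}

/-- The domain of the warped product. -/
def warpedDomain (α : Fin n → ℝ) (β : Fin m → ℝ) (I J : Set ℝ) : Set (Fin n ⊕ Fin m → ℝ) :=
  {x | lin (Sum.elim α 0) x ∈ I ∧ lin (Sum.elim 0 β) x ∈ J}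

theorem isOpen_warpedDomain (hI : IsOpen I) (hJ : IsOpen J) : IsOpen (warpedDomain α β I J) :=
  (isOpen_lin_mem hI _).inter (isOpen_lin_mem hJ _)

theorem exists_mem_warpedDomain (hα : α ≠ 0) (hβ : β ≠ 0) (s t : ℝ) :
    ∃ x : Fin n ⊕ Fin m → ℝ, lin (Sum.elim α 0) x = s ∧ lin (Sum.elim 0 β) x = t := by
  obtain ⟨p, hp⟩ := exists_lin_eq hα s
  obtain ⟨q, hq⟩ := exists_lin_eq hβ t
  exact ⟨Sum.elim p q, by rw [← lin_inl, Sum.elim_comp_inl, hp],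
    by rw [← lin_inr, Sum.elim_comp_inr, hq]⟩

theorem warpedMetric_eq_diagonal (x : Fin n ⊕ Fin m → ℝ) :
    warpedMetric (conformalMetric ε fun p => φ (lin α p)) (fun p => f (lin α p))
      (conformalMetric δ fun q => τ (lin β q)) x =
      Matrix.diagonal fun k => warpedEntry ε α δ β φ f τ k x := by
  unfold warpedMetric conformalMetric warpedEntry
  simp only [lin_inl, lin_inr]
  rw [← Matrix.diagonal_smul, Matrix.fromBlocks_diagonal]
  congr 1

theorem isDiagonalOn_warped (hε : ∀ i, ε i = 1 ∨ ε i = -1) (hδ : ∀ j, δ j = 1 ∨ δ j = -1)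
    (hI : IsOpen I) (hJ : IsOpen J) (hφ : ContDiffOn ℝ ∞ φ I) (hφ0 : ∀ ξ ∈ I, 0 < φ ξ)
    (hf : ContDiffOn ℝ ∞ f I) (hf0 : ∀ ξ ∈ I, 0 < f ξ)
    (hτ : ContDiffOn ℝ ∞ τ J) (hτ0 : ∀ ζ ∈ J, 0 < τ ζ) :
    IsDiagonalOn (warpedDomain α β I J)
      (warpedMetric (conformalMetric ε fun p => φ (lin α p)) (fun p => f (lin α p))
        (conformalMetric δ fun q => τ (lin β q)))
      (warpedEntry ε α δ β φ f τ) (warpedLog α β φ f τ) (warpedLog₂ α β φ f τ) := by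
  have dφ : ∀ (i : Fin n) s, s ∈ I → HasDerivAt (fun s => ε i / φ s ^ 2)
      (ε i * (-(2 * φ s * deriv φ s) / (φ s ^ 2) ^ 2)) s := fun i s hs => by
    simpa [div_eq_mul_inv] using (((hasDerivAt_of_smooth hI hφ hs).fun_pow 2).fun_inv
      (pow_ne_zero _ (hφ0 _ hs).ne')).const_mul (ε i)
  have df : ∀ s, s ∈ I → HasDerivAt (fun s => f s ^ 2) (2 * f s * deriv f s) s := fun s hs => by
    simpa using (hasDerivAt_of_smooth hI hf hs).fun_pow 2
  have dτ : ∀ (i : Fin m) s, s ∈ J → HasDerivAt (fun s => δ i / τ s ^ 2)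
      (δ i * (-(2 * τ s * deriv τ s) / (τ s ^ 2) ^ 2)) s := fun i s hs => by
    simpa [div_eq_mul_inv] using (((hasDerivAt_of_smooth hJ hτ hs).fun_pow 2).fun_inv
      (pow_ne_zero _ (hτ0 _ hs).ne')).const_mul (δ i)
  have eφ := fun s (hs : s ∈ I) => hasDerivAt_of_smooth hI (smooth_logDeriv hI hφ hφ0) hs
  have ef := fun s (hs : s ∈ I) => hasDerivAt_of_smooth hI (smooth_logDeriv hI hf hf0) hs
  have eτ := fun s (hs : s ∈ J) => hasDerivAt_of_smooth hJ (smooth_logDeriv hJ hτ hτ0) hs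
  refine ⟨isOpen_warpedDomain hI hJ, warpedMetric_eq_diagonal, ?_, ?_, ?_, ?_, ?_, ?_⟩
  · rintro x ⟨h1, h2⟩ (k | k)
    · exact div_ne_zero (sign_ne_zero' hε k) (pow_ne_zero _ (hφ0 _ h1).ne')
    · exact mul_ne_zero (pow_ne_zero _ (hf0 _ h1).ne')
        (div_ne_zero (sign_ne_zero' hδ k) (pow_ne_zero _ (hτ0 _ h2).ne'))
  · rintro x ⟨h1, h2⟩ (k | k)
    · exact differentiableAt_comp_lin (dφ k _ h1)
    · exact (differentiableAt_comp_lin (df _ h1)).fun_mul (differentiableAt_comp_lin (dτ k _ h2))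
  · rintro x ⟨h1, h2⟩ (k | k) i
    · have := (hφ0 _ h1).ne'
      simp only [warpedEntry, warpedLog, Sum.elim_inl]
      refine (pd_comp_lin i (dφ k _ h1)).trans ?_
      rw [logDeriv_apply]
      field_simp
    · have a1 := (hf0 _ h1).ne'
      have a2 := (hτ0 _ h2).ne'
      simp only [warpedEntry, warpedLog, Sum.elim_inr]
      refine (pd_mul i (differentiableAt_comp_lin (df _ h1))
        (differentiableAt_comp_lin (dτ k _ h2))).trans ?_
      rw [pd_comp_lin i (df _ h1), pd_comp_lin i (dτ k _ h2), logDeriv_apply, logDeriv_apply]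
      field_simp
      ring
  · rintro x ⟨h1, h2⟩ (k | k) i
    · exact ((differentiableAt_comp_lin (eφ _ h1)).mul_const _).neg
    · exact ((differentiableAt_comp_lin (ef _ h1)).mul_const _).sub
        ((differentiableAt_comp_lin (eτ _ h2)).mul_const _)
  · rintro x ⟨h1, h2⟩ (k | k) i j
    · simp only [warpedLog₂, Sum.elim_inl]
      refine (pd_comp_lin (F := fun s => -(logDeriv φ s * _)) j
        ((eφ _ h1).mul_const _).neg).trans ?_
      ring
    · simp only [warpedLog₂, Sum.elim_inr]
      refine (pd_sub j ((differentiableAt_comp_lin (ef _ h1)).mul_const _)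
        ((differentiableAt_comp_lin (eτ _ h2)).mul_const _)).trans ?_
      rw [pd_comp_lin (F := fun s => logDeriv f s * _) j ((ef _ h1).mul_const _),
        pd_comp_lin (F := fun s => logDeriv τ s * _) j ((eτ _ h2).mul_const _)]
      ring
  · rintro (k | k) i j <;> funext x <;> simp only [warpedLog₂, Sum.elim_inl, Sum.elim_inr] <;> ring

/-! ### Curvature, Hessian and tension of the warped product, block by block -/

section Curvature

variable (hε : ∀ i, ε i = 1 ∨ ε i = -1) (hδ : ∀ j, δ j = 1 ∨ δ j = -1)
    (hI : IsOpen I) (hJ : IsOpen J) (hφ : ContDiffOn ℝ ∞ φ I) (hφ0 : ∀ ξ ∈ I, 0 < φ ξ)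
    (hf : ContDiffOn ℝ ∞ f I) (hf0 : ∀ ξ ∈ I, 0 < f ξ)
    (hτ : ContDiffOn ℝ ∞ τ J) (hτ0 : ∀ ζ ∈ J, 0 < τ ζ)
    (hh : ContDiffOn ℝ ∞ h I) (hu : ContDiffOn ℝ ∞ u J)
    {x : Fin n ⊕ Fin m → ℝ} (hx : x ∈ warpedDomain α β I J)

include hε hδ hI hJ hφ hφ0 hf hf0 hτ hτ0 hx

theorem warped_ricci_inl_inl (i j : Fin n) :
    ricci (warpedMetric (conformalMetric ε fun p => φ (lin α p)) (fun p => f (lin α p))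
        (conformalMetric δ fun q => τ (lin β q))) (Sum.inl i) (Sum.inl j) x =
      (((n : ℝ) - 2) * (deriv (logDeriv φ) (lin (Sum.elim α 0) x)
          + logDeriv φ (lin (Sum.elim α 0) x) ^ 2)
        - m * (deriv (logDeriv f) (lin (Sum.elim α 0) x) + logDeriv f (lin (Sum.elim α 0) x) ^ 2
          + 2 * logDeriv φ (lin (Sum.elim α 0) x) * logDeriv f (lin (Sum.elim α 0) x)))
        * (α i * α j)
      + (if i = j then 1 else 0) * (ε i * (sqNorm ε α * (deriv (logDeriv φ) (lin (Sum.elim α 0) x)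
        - ((n : ℝ) - 2) * logDeriv φ (lin (Sum.elim α 0) x) ^ 2
        + m * logDeriv φ (lin (Sum.elim α 0) x) * logDeriv f (lin (Sum.elim α 0) x)))) := by
  rw [(isDiagonalOn_warped hε hδ hI hJ hφ hφ0 hf hf0 hτ hτ0).ricci_eq hx]
  have h0 := (hφ0 _ hx.1).ne'
  simp only [warpedEntry, warpedLog, warpedLog₂, Fintype.sum_sum_type, Sum.elim_inl, Sum.elim_inr,
    Finset.sum_const, Finset.card_univ, Fintype.card_fin, nsmul_eq_mul, Pi.zero_apply, mul_zero,
    zero_mul, sub_zero, neg_zero, add_zero, Finset.sum_const_zero, Sum.inl.injEq]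
  set p := logDeriv φ (lin (Sum.elim α 0) x)
  set p' := deriv (logDeriv φ) (lin (Sum.elim α 0) x)
  set q := logDeriv f (lin (Sum.elim α 0) x)
  set q' := deriv (logDeriv f) (lin (Sum.elim α 0) x)
  set P := φ (lin (Sum.elim α 0) x)
  have : ∀ k, ε i / P ^ 2 / (ε k / P ^ 2) *
      (-(p' * (α k * α k)) - 2 * -(p * α k) * -(p * α k)
        + (n * -(p * α k) + m * (q * α k)) * -(p * α k)) =
      (-p' - 2 * p ^ 2 + (n * p - m * q) * p) * (ε i / ε k * (α k * α k)) := by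
    intro k
    have := sign_ne_zero' hε k
    field_simp
    ring
  simp only [this, ← Finset.mul_sum, sum_sign_mul_sq hε]
  ring

/-- The first two terms are the Ricci tensor of the fiber itself. The last is the fiber metric times
a function of `ξ`, and it is all that remains once the fiber equations are used. -/
theorem warped_ricci_inr_inr (i j : Fin m) :
    ricci (warpedMetric (conformalMetric ε fun p => φ (lin α p)) (fun p => f (lin α p))
        (conformalMetric δ fun q => τ (lin β q))) (Sum.inr i) (Sum.inr j) x =
      ((m : ℝ) - 2) * (deriv (logDeriv τ) (lin (Sum.elim 0 β) x)
        + logDeriv τ (lin (Sum.elim 0 β) x) ^ 2) * (β i * β j)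
      + (if i = j then 1 else 0) * (δ i * (sqNorm δ β * (deriv (logDeriv τ) (lin (Sum.elim 0 β) x)
        - ((m : ℝ) - 2) * logDeriv τ (lin (Sum.elim 0 β) x) ^ 2)))
      - (if i = j then 1 else 0) * (δ i * (f (lin (Sum.elim α 0) x) ^ 2
        * φ (lin (Sum.elim α 0) x) ^ 2 / τ (lin (Sum.elim 0 β) x) ^ 2
        * (sqNorm ε α * (deriv (logDeriv f) (lin (Sum.elim α 0) x)
        - ((n : ℝ) - 2) * logDeriv φ (lin (Sum.elim α 0) x) * logDeriv f (lin (Sum.elim α 0) x)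
        + m * logDeriv f (lin (Sum.elim α 0) x) ^ 2)))) := by
  rw [(isDiagonalOn_warped hε hδ hI hJ hφ hφ0 hf hf0 hτ hτ0).ricci_eq hx]
  have h0 := (hφ0 _ hx.1).ne'
  have h1 := (hf0 _ hx.1).ne'
  have h2 := (hτ0 _ hx.2).ne'
  simp only [warpedEntry, warpedLog, warpedLog₂, Fintype.sum_sum_type, Sum.elim_inl, Sum.elim_inr,
    Finset.sum_const, Finset.card_univ, Fintype.card_fin, nsmul_eq_mul, Pi.zero_apply, mul_zero,
    zero_mul, sub_zero, zero_sub, neg_zero, add_zero, zero_add, Finset.sum_const_zero,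
    Sum.inr.injEq]
  set p := logDeriv φ (lin (Sum.elim α 0) x)
  set q := logDeriv f (lin (Sum.elim α 0) x)
  set q' := deriv (logDeriv f) (lin (Sum.elim α 0) x)
  set t := logDeriv τ (lin (Sum.elim 0 β) x)
  set t' := deriv (logDeriv τ) (lin (Sum.elim 0 β) x)
  set P := φ (lin (Sum.elim α 0) x)
  set Q := f (lin (Sum.elim α 0) x)
  set T := τ (lin (Sum.elim 0 β) x)
  have e1 : ∀ k, Q ^ 2 * (δ i / T ^ 2) / (ε k / P ^ 2) *
      (q' * (α k * α k) - 2 * -(p * α k) * (q * α k)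
        + (n * -(p * α k) + m * (q * α k)) * (q * α k)) =
      δ i * (Q ^ 2 * P ^ 2 / T ^ 2 * (q' + 2 * p * q - n * p * q + m * q ^ 2)) *
        (1 / ε k * (α k * α k)) := by
    intro k
    have := sign_ne_zero' hε k
    field_simp
    ring
  have e2 : ∀ k, Q ^ 2 * (δ i / T ^ 2) / (Q ^ 2 * (δ k / T ^ 2)) *
      (-(t' * (β k * β k)) - 2 * -(t * β k) * -(t * β k) + m * -(t * β k) * -(t * β k)) =
      (-t' - 2 * t ^ 2 + m * t ^ 2) * (δ i / δ k * (β k * β k)) := by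
    intro k
    have := sign_ne_zero' hδ k
    field_simp
  simp only [e1, e2, ← Finset.mul_sum, sum_sign_mul_sq hε, sum_sign_mul_sq hδ]
  ring

/-- The logarithm of each entry is a function of `ξ` plus a function of `ζ`, so mixed second
derivatives vanish. The surviving products of first derivatives cancel, because `W k i` is the same
for all fiber indices `k`. -/
theorem warped_ricci_inl_inr (i : Fin n) (j : Fin m) :
    ricci (warpedMetric (conformalMetric ε fun p => φ (lin α p)) (fun p => f (lin α p))
        (conformalMetric δ fun q => τ (lin β q))) (Sum.inl i) (Sum.inr j) x = 0 := by
  rw [(isDiagonalOn_warped hε hδ hI hJ hφ hφ0 hf hf0 hτ hτ0).ricci_eq hx]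
  simp [warpedLog, warpedLog₂]
  ring

theorem warped_ricci_inr_inl (i : Fin m) (j : Fin n) :
    ricci (warpedMetric (conformalMetric ε fun p => φ (lin α p)) (fun p => f (lin α p))
        (conformalMetric δ fun q => τ (lin β q))) (Sum.inr i) (Sum.inl j) x = 0 := by
  rw [(isDiagonalOn_warped hε hδ hI hJ hφ hφ0 hf hf0 hτ hτ0).ricci_eq hx]
  simp [warpedLog, warpedLog₂]
  ring

include hh in
theorem warped_hess_inl_inl (i j : Fin n) :
    hess (warpedMetric (conformalMetric ε fun p => φ (lin α p)) (fun p => f (lin α p))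
        (conformalMetric δ fun q => τ (lin β q))) (fun x => h (lin (Sum.elim α 0) x))
        (Sum.inl i) (Sum.inl j) x =
      (deriv (deriv h) (lin (Sum.elim α 0) x)
        + 2 * logDeriv φ (lin (Sum.elim α 0) x) * deriv h (lin (Sum.elim α 0) x)) * (α i * α j)
      - (if i = j then 1 else 0) * (ε i * (sqNorm ε α *
        (logDeriv φ (lin (Sum.elim α 0) x) * deriv h (lin (Sum.elim α 0) x)))) := by
  rw [(isDiagonalOn_warped hε hδ hI hJ hφ hφ0 hf hf0 hτ hτ0).hess_eq _ hx]
  have h0 := (hφ0 _ hx.1).ne'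
  simp only [pd_pd_comp_lin hI hh hx.1, pd_comp_lin _ (hasDerivAt_of_smooth hI hh hx.1),
    warpedEntry, warpedLog, Fintype.sum_sum_type, Sum.elim_inl, Sum.elim_inr,
    Pi.zero_apply, mul_zero, zero_mul, neg_zero, add_zero, Finset.sum_const_zero, Sum.inl.injEq]
  set p := logDeriv φ (lin (Sum.elim α 0) x)
  set h' := deriv h (lin (Sum.elim α 0) x)
  set P := φ (lin (Sum.elim α 0) x)
  have e1 : ∀ k, ε i / P ^ 2 / (ε k / P ^ 2) * (-(p * α k) * (h' * α k)) =
      - (p * h') * (ε i / ε k * (α k * α k)) := by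
    intro k
    have := sign_ne_zero' hε k
    field_simp
  simp only [e1, ← Finset.mul_sum, sum_sign_mul_sq hε]
  ring

include hh in
theorem warped_hess_inr_inr (i j : Fin m) :
    hess (warpedMetric (conformalMetric ε fun p => φ (lin α p)) (fun p => f (lin α p))
        (conformalMetric δ fun q => τ (lin β q))) (fun x => h (lin (Sum.elim α 0) x))
        (Sum.inr i) (Sum.inr j) x =
      (if i = j then 1 else 0) * (δ i * (f (lin (Sum.elim α 0) x) ^ 2
        * φ (lin (Sum.elim α 0) x) ^ 2 / τ (lin (Sum.elim 0 β) x) ^ 2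
        * (sqNorm ε α *
        (logDeriv f (lin (Sum.elim α 0) x) * deriv h (lin (Sum.elim α 0) x))))) := by
  rw [(isDiagonalOn_warped hε hδ hI hJ hφ hφ0 hf hf0 hτ hτ0).hess_eq _ hx]
  have h0 := (hφ0 _ hx.1).ne'
  have h2 := (hτ0 _ hx.2).ne'
  simp only [pd_pd_comp_lin hI hh hx.1, pd_comp_lin _ (hasDerivAt_of_smooth hI hh hx.1),
    warpedEntry, warpedLog, Fintype.sum_sum_type, Sum.elim_inl, Sum.elim_inr,
    Pi.zero_apply, mul_zero, zero_mul, neg_zero, add_zero, sub_zero, zero_add,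
    Finset.sum_const_zero, Sum.inr.injEq]
  set q := logDeriv f (lin (Sum.elim α 0) x)
  set h' := deriv h (lin (Sum.elim α 0) x)
  set P := φ (lin (Sum.elim α 0) x)
  set Q := f (lin (Sum.elim α 0) x)
  set T := τ (lin (Sum.elim 0 β) x)
  have e1 : ∀ k, Q ^ 2 * (δ i / T ^ 2) / (ε k / P ^ 2) * (q * α k * (h' * α k)) =
      δ i * (Q ^ 2 * P ^ 2 / T ^ 2 * (q * h')) * (1 / ε k * (α k * α k)) := by
    intro k
    have := sign_ne_zero' hε k
    field_simp
  simp only [e1, ← Finset.mul_sum, sum_sign_mul_sq hε]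
  ring

include hh in
theorem warped_hess_inl_inr (i : Fin n) (j : Fin m) :
    hess (warpedMetric (conformalMetric ε fun p => φ (lin α p)) (fun p => f (lin α p))
        (conformalMetric δ fun q => τ (lin β q))) (fun x => h (lin (Sum.elim α 0) x))
        (Sum.inl i) (Sum.inr j) x = 0 := by
  rw [(isDiagonalOn_warped hε hδ hI hJ hφ hφ0 hf hf0 hτ hτ0).hess_eq _ hx]
  simp [pd_pd_comp_lin hI hh hx.1, pd_comp_lin _ (hasDerivAt_of_smooth hI hh hx.1), warpedLog]

include hh in
theorem warped_hess_inr_inl (i : Fin m) (j : Fin n) :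
    hess (warpedMetric (conformalMetric ε fun p => φ (lin α p)) (fun p => f (lin α p))
        (conformalMetric δ fun q => τ (lin β q))) (fun x => h (lin (Sum.elim α 0) x))
        (Sum.inr i) (Sum.inl j) x = 0 := by
  rw [(isDiagonalOn_warped hε hδ hI hJ hφ hφ0 hf hf0 hτ hτ0).hess_eq _ hx]
  simp [pd_pd_comp_lin hI hh hx.1, pd_comp_lin _ (hasDerivAt_of_smooth hI hh hx.1), warpedLog]

include hu in
-- The function `u` is constant along the base and the base entries do not depend on `ζ`, so the
-- trace sees only the fiber block: the result is the tension on the fiber divided by `f²`.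
theorem warped_tension :
    tension (warpedMetric (conformalMetric ε fun p => φ (lin α p)) (fun p => f (lin α p))
        (conformalMetric δ fun q => τ (lin β q))) (fun x => u (lin (Sum.elim 0 β) x)) x =
      τ (lin (Sum.elim 0 β) x) ^ 2 / f (lin (Sum.elim α 0) x) ^ 2 * (sqNorm δ β *
        (deriv (deriv u) (lin (Sum.elim 0 β) x) - ((m : ℝ) - 2)
          * logDeriv τ (lin (Sum.elim 0 β) x) * deriv u (lin (Sum.elim 0 β) x))) := by
  have H := isDiagonalOn_warped (α := α) (β := β) hε hδ hI hJ hφ hφ0 hf hf0 hτ hτ0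
  rw [H.tension_eq _ hx]
  have h1 := (hf0 _ hx.1).ne'
  have h2 := (hτ0 _ hx.2).ne'
  simp only [H.hess_eq _ hx, pd_pd_comp_lin hJ hu hx.2, if_true,
    pd_comp_lin _ (hasDerivAt_of_smooth hJ hu hx.2),
    warpedEntry, warpedLog, Fintype.sum_sum_type, Sum.elim_inl, Sum.elim_inr,
    Pi.zero_apply, mul_zero, zero_mul, neg_zero, add_zero, sub_zero, zero_add, zero_sub,
    Finset.sum_const_zero]
  set t := logDeriv τ (lin (Sum.elim 0 β) x)
  set u' := deriv u (lin (Sum.elim 0 β) x)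
  set u'' := deriv (deriv u) (lin (Sum.elim 0 β) x)
  set Q := f (lin (Sum.elim α 0) x)
  set T := τ (lin (Sum.elim 0 β) x)
  have e1 : ∀ i, ∑ k, Q ^ 2 * (δ i / T ^ 2) / (Q ^ 2 * (δ k / T ^ 2)) *
      (-(t * β k) * (u' * β k)) = - t * u' * (δ i * sqNorm δ β) := by
    intro i
    rw [← sum_sign_mul_sq hδ, Finset.mul_sum]
    refine Finset.sum_congr rfl fun k _ => ?_
    have := sign_ne_zero' hδ k
    field_simp
  simp only [e1]
  have e2 : ∀ i, (Q ^ 2 * (δ i / T ^ 2))⁻¹ * (u'' * (β i * β i) - -(t * β i) * (u' * β i)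
      - -(t * β i) * (u' * β i) + 1 * (-t * u' * (δ i * sqNorm δ β))) =
      T ^ 2 / Q ^ 2 * (u'' + 2 * t * u') * (1 / δ i * (β i * β i))
      - T ^ 2 / Q ^ 2 * t * u' * sqNorm δ β := by
    intro i
    have := sign_ne_zero' hδ i
    field_simp
    ring
  simp only [e2, Finset.sum_sub_distrib, ← Finset.mul_sum, sum_sign_mul_sq hδ, Finset.sum_const,
    Finset.card_univ, Fintype.card_fin, nsmul_eq_mul]
  ring

include hh hu in
-- The gradients lie in orthogonal factors, so the potential drops out of the harmonicity equation,
-- which becomes that of the fiber.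
theorem warped_gradInner :
    gradInner (warpedMetric (conformalMetric ε fun p => φ (lin α p)) (fun p => f (lin α p))
        (conformalMetric δ fun q => τ (lin β q))) (fun x => u (lin (Sum.elim 0 β) x))
        (fun x => h (lin (Sum.elim α 0) x)) x = 0 := by
  rw [(isDiagonalOn_warped hε hδ hI hJ hφ hφ0 hf hf0 hτ hτ0).gradInner_eq _ _ hx]
  simp [pd_comp_lin _ (hasDerivAt_of_smooth hI hh hx.1),
    pd_comp_lin _ (hasDerivAt_of_smooth hJ hu hx.2)]

omit hx in
theorem isMetricOn_warped : IsMetricOn (warpedDomain α β I J)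
    (warpedMetric (conformalMetric ε fun p => φ (lin α p)) (fun p => f (lin α p))
        (conformalMetric δ fun q => τ (lin β q))) where
  isOpen := isOpen_warpedDomain hI hJ
  smooth i j := by
    simp only [warpedMetric_eq_diagonal]
    by_cases h : i = j
    · subst h
      simp only [Matrix.diagonal_apply_eq]
      have c1 := contDiffOn_comp_lin hφ (Sum.elim α (0 : Fin m → ℝ))
        (U := warpedDomain α β I J) fun _ h => h.1
      have c2 := contDiffOn_comp_lin hf (Sum.elim α (0 : Fin m → ℝ))
        (U := warpedDomain α β I J) fun _ h => h.1
      have c3 := contDiffOn_comp_lin hτ (Sum.elim (0 : Fin n → ℝ) β)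
        (U := warpedDomain α β I J) fun _ h => h.2
      rcases i with i | i
      · exact contDiffOn_const.div (c1.pow 2) fun x hx => pow_ne_zero _ (hφ0 _ hx.1).ne'
      · exact (c2.pow 2).mul (contDiffOn_const.div (c3.pow 2)
          fun x hx => pow_ne_zero _ (hτ0 _ hx.2).ne')
    · simp only [Matrix.diagonal_apply_ne _ h]
      exact contDiffOn_const
  symm x _ := by
    rw [warpedMetric_eq_diagonal]
    exact Matrix.isSymm_diagonal _
  nondegenerate x hx := by
    rw [warpedMetric_eq_diagonal, Matrix.det_diagonal]
    exact Finset.prod_ne_zero_iff.2 fun i _ =>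
      (isDiagonalOn_warped hε hδ hI hJ hφ hφ0 hf hf0 hτ hτ0).ne_zero x hx i

end Curvature

/-- The ordinary differential equations of the base of a steady soliton with steady fiber. -/
def BaseODE (n m : ℕ) (N : ℝ) (I : Set ℝ) (φ f h : ℝ → ℝ) : Prop :=
  ∀ ξ ∈ I,
    ((n : ℝ) - 2) * (deriv (logDeriv φ) ξ + logDeriv φ ξ ^ 2)
      - m * (deriv (logDeriv f) ξ + logDeriv f ξ ^ 2 + 2 * logDeriv φ ξ * logDeriv f ξ)
      + (deriv (deriv h) ξ + 2 * logDeriv φ ξ * deriv h ξ) = 0 ∧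
    N * (deriv (logDeriv φ) ξ -
      logDeriv φ ξ * (((n : ℝ) - 2) * logDeriv φ ξ - m * logDeriv f ξ + deriv h ξ)) = 0 ∧
    N * (deriv (logDeriv f) ξ -
      logDeriv f ξ * (((n : ℝ) - 2) * logDeriv φ ξ - m * logDeriv f ξ + deriv h ξ)) = 0

theorem isSteadyWithSteadyFiber_iff (hn : 1 < n) (hm : 3 ≤ m)
    (hε : ∀ i, ε i = 1 ∨ ε i = -1) (hδ : ∀ j, δ j = 1 ∨ δ j = -1)
    (hα : α ≠ 0) (hβ : β ≠ 0) {θ : ℝ} (hθ : 0 < θ)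
    (hI : IsOpen I) (hJ : IsOpen J) (hJne : J.Nonempty)
    (hφ : ContDiffOn ℝ ∞ φ I) (hf : ContDiffOn ℝ ∞ f I) (hh : ContDiffOn ℝ ∞ h I)
    (hτ : ContDiffOn ℝ ∞ τ J) (hu : ContDiffOn ℝ ∞ u J)
    (hφ0 : ∀ ξ ∈ I, 0 < φ ξ) (hf0 : ∀ ξ ∈ I, 0 < f ξ) (hτ0 : ∀ ζ ∈ J, 0 < τ ζ) :
    IsSteadyWithSteadyFiber ε α δ β θ I J φ f h τ u ↔
      BaseODE n m (sqNorm ε α) I φ f h ∧ FiberODE m θ (sqNorm δ β) J τ u := by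
  have : Nontrivial (Fin n) := Fin.nontrivial_iff_two_le.2 (by omega)
  have hm0 : Nonempty (Fin m) := ⟨⟨0, by omega⟩⟩
  unfold IsSteadyWithSteadyFiber
  rw [isHarmonicEinstein_iff hm hδ hβ hθ hJ hτ hτ0 hu]
  refine and_congr_left fun hF => ?_
  simp only [lin_inl, lin_inr]
  constructor
  · intro H ξ hξ
    obtain ⟨ζ, hζ⟩ := hJne
    obtain ⟨x, rfl, rfl⟩ := exists_mem_warpedDomain hα hβ ξ ζ
    have hx : x ∈ warpedDomain α β I J := ⟨hξ, hζ⟩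
    have hs := H.soliton x hx
    have h1 : ∀ i j : Fin n, _ := fun i j => hs (Sum.inl i) (Sum.inl j)
    obtain ⟨a⟩ := hm0
    -- A single diagonal fiber entry suffices: after the fiber equations cancel its other terms, it
    -- is a nonzero multiple of the third base equation.
    have h2 := hs (Sum.inr a) (Sum.inr a)
    simp only [warped_ricci_inl_inl hε hδ hI hJ hφ hφ0 hf hf0 hτ hτ0 hx,
      warped_hess_inl_inl hε hδ hI hJ hφ hφ0 hf hf0 hτ hτ0 hh hx,
      pd_comp_lin _ (hasDerivAt_of_smooth hJ hu hζ), Sum.elim_inl, Pi.zero_apply, mul_zero,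
      zero_mul] at h1
    rw [warped_ricci_inr_inr hε hδ hI hJ hφ hφ0 hf hf0 hτ hτ0 hx,
      warped_hess_inr_inr hε hδ hI hJ hφ hφ0 hf hf0 hτ hτ0 hh hx] at h2
    simp only [pd_comp_lin _ (hasDerivAt_of_smooth hJ hu hζ), Sum.elim_inr, if_true] at h2
    obtain ⟨f1, f2, -⟩ := hF _ hζ
    have p1 := (hφ0 _ hξ).ne'
    have p2 := (hf0 _ hξ).ne'
    have p3 := (hτ0 _ hζ).ne'
    rw [f1, f2] at h2
    set p := logDeriv φ (lin (Sum.elim α 0) x)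
    set p' := deriv (logDeriv φ) (lin (Sum.elim α 0) x)
    set q := logDeriv f (lin (Sum.elim α 0) x)
    set q' := deriv (logDeriv f) (lin (Sum.elim α 0) x)
    set h' := deriv h (lin (Sum.elim α 0) x)
    set h'' := deriv (deriv h) (lin (Sum.elim α 0) x)
    set P := φ (lin (Sum.elim α 0) x)
    set Q := f (lin (Sum.elim α 0) x)
    set T := τ (lin (Sum.elim 0 β) x)
    obtain ⟨g1, g2⟩ := rank_one_add_diagonal_eq_zero hε hα
      (X := ((n : ℝ) - 2) * (p' + p ^ 2) - m * (q' + q ^ 2 + 2 * p * q) + (h'' + 2 * p * h'))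
      (Y := sqNorm ε α * (p' - p * (((n : ℝ) - 2) * p - m * q + h'))) fun i j => by
        linear_combination h1 i j
    refine ⟨g1, g2, ?_⟩
    have h3 : δ a * (Q ^ 2 * P ^ 2 / T ^ 2) *
        (sqNorm ε α * (q' - q * (((n : ℝ) - 2) * p - m * q + h'))) = 0 := by
      linear_combination -h2
    have := sign_ne_zero' hδ a
    exact (mul_eq_zero.1 h3).resolve_left (by positivity)
  · intro H
    refine ⟨isMetricOn_warped hε hδ hI hJ hφ hφ0 hf hf0 hτ hτ0,
      contDiffOn_comp_lin hh _ fun _ h => h.1, contDiffOn_comp_lin hu _ fun _ h => h.2, hθ.le,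
      ?_, ?_⟩
    · intro x hx i j
      have hx : x ∈ warpedDomain α β I J := hx
      obtain ⟨f1, f2, -⟩ := hF _ hx.2
      obtain ⟨g1, g2, g3⟩ := H _ hx.1
      rcases i with i | i <;> rcases j with j | j
      · rw [warped_ricci_inl_inl hε hδ hI hJ hφ hφ0 hf hf0 hτ hτ0 hx,
          warped_hess_inl_inl hε hδ hI hJ hφ hφ0 hf hf0 hτ hτ0 hh hx]
        simp only [pd_comp_lin _ (hasDerivAt_of_smooth hJ hu hx.2), Sum.elim_inl, Pi.zero_apply]
        linear_combination (α i * α j) * g1 + (if i = j then 1 else 0) * ε i * g2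
      · rw [warped_ricci_inl_inr hε hδ hI hJ hφ hφ0 hf hf0 hτ hτ0 hx,
          warped_hess_inl_inr hε hδ hI hJ hφ hφ0 hf hf0 hτ hτ0 hh hx]
        simp [pd_comp_lin _ (hasDerivAt_of_smooth hJ hu hx.2)]
      · rw [warped_ricci_inr_inl hε hδ hI hJ hφ hφ0 hf hf0 hτ hτ0 hx,
          warped_hess_inr_inl hε hδ hI hJ hφ hφ0 hf hf0 hτ hτ0 hh hx]
        simp [pd_comp_lin _ (hasDerivAt_of_smooth hJ hu hx.2)]
      · rw [warped_ricci_inr_inr hε hδ hI hJ hφ hφ0 hf hf0 hτ hτ0 hx,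
          warped_hess_inr_inr hε hδ hI hJ hφ hφ0 hf hf0 hτ hτ0 hh hx]
        simp only [pd_comp_lin _ (hasDerivAt_of_smooth hJ hu hx.2), Sum.elim_inr]
        linear_combination (β i * β j) * f1 + (if i = j then 1 else 0) * δ i * f2
          - (if i = j then 1 else 0) * δ i * (f (lin (Sum.elim α 0) x) ^ 2
            * φ (lin (Sum.elim α 0) x) ^ 2 / τ (lin (Sum.elim 0 β) x) ^ 2) * g3
    · intro x hx
      have hx : x ∈ warpedDomain α β I J := hx
      obtain ⟨-, -, f3⟩ := hF _ hx.2
      rw [warped_tension hε hδ hI hJ hφ hφ0 hf hf0 hτ hτ0 hu hx,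
        warped_gradInner hε hδ hI hJ hφ hφ0 hf hf0 hτ hτ0 hh hu hx, f3]
      ring

end Warped

/-! ### First-order equations on an open interval -/

section Interval

variable {I : Set ℝ} {F G a : ℝ → ℝ}

theorem eq_of_hasDerivAt_zero (hI : IsOpen I) (hI' : I.OrdConnected)
    (h : ∀ s ∈ I, HasDerivAt F 0 s) {x y : ℝ} (hx : x ∈ I) (hy : y ∈ I) : F x = F y :=
  hI.is_const_of_deriv_eq_zero hI'.isPreconnected
    (fun s hs => (h s hs).differentiableAt.differentiableWithinAt) (fun s hs => (h s hs).deriv) hx hy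

theorem eqOn_add_const (hI : IsOpen I) (hI' : I.OrdConnected) {x₀ : ℝ} (hx₀ : x₀ ∈ I)
    (hF : ∀ s ∈ I, HasDerivAt F (a s) s) (hG : ∀ s ∈ I, HasDerivAt G (a s) s) :
    ∃ c, ∀ s ∈ I, F s = G s + c := by
  refine ⟨F x₀ - G x₀, fun s hs => ?_⟩
  have : F s - G s = F x₀ - G x₀ := eq_of_hasDerivAt_zero (F := fun s => F s - G s) hI hI'
    (fun s hs => by simpa using (hF s hs).fun_sub (hG s hs)) hs hx₀
  linarith

theorem hasDerivAt_integral (hI : IsOpen I) (hI' : I.OrdConnected) {x₀ x : ℝ} (hx₀ : x₀ ∈ I)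
    (hx : x ∈ I) (ha : ContinuousOn a I) : HasDerivAt (fun y => ∫ s in x₀..y, a s) (a x) x :=
  intervalIntegral.integral_hasDerivAt_right
    ((ha.mono (hI'.uIcc_subset hx₀ hx)).intervalIntegrable)
    (ha.stronglyMeasurableAtFilter hI x hx) (ha.continuousAt (hI.mem_nhds hx))

theorem hasDerivAt_congr_on (hI : IsOpen I) (h : ∀ s ∈ I, F s = G s) {x c : ℝ} (hx : x ∈ I)
    (hG : HasDerivAt G c x) : HasDerivAt F c x :=
  hG.congr_of_eventuallyEq (Filter.eventuallyEq_of_mem (hI.mem_nhds hx) h)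

/-- A solution of the linear equation `F' = a F` which vanishes somewhere vanishes everywhere. -/
theorem eq_zero_of_linear_ode (hI : IsOpen I) (hI' : I.OrdConnected) (ha : ContinuousOn a I)
    (h : ∀ s ∈ I, HasDerivAt F (a s * F s) s) {x y : ℝ} (hx : x ∈ I) (h0 : F x = 0)
    (hy : y ∈ I) : F y = 0 := by
  -- The integrating factor makes the product constant; its value at `x` is zero.
  have := eq_of_hasDerivAt_zero (F := fun s => F s * Real.exp (-∫ r in x..s, a r)) hI hI'
    (fun s hs => by
      have := (h s hs).fun_mul (hasDerivAt_integral hI hI' hx hs ha).fun_neg.exp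
      refine HasDerivAt.congr_deriv (this) ?_
      ring) hx hy
  simp only [h0, zero_mul] at this
  exact (mul_eq_zero.1 this.symm).resolve_right (Real.exp_ne_zero _)

/-- Both `|F|` and `F` are continuous square roots of `F²`, so on a connected set without zeros they
agree up to one global sign. -/
theorem abs_eq_sign_mul (hI' : I.OrdConnected) (hF : ContinuousOn F I) (h0 : ∀ s ∈ I, F s ≠ 0) :
    ∃ σ : ℝ, (σ = 1 ∨ σ = -1) ∧ ∀ s ∈ I, |F s| = σ * F s := by
  rcases hI'.isPreconnected.eq_or_eq_neg_of_sq_eq (f := fun s => |F s|) hF.abs hF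
    (fun s _ => by simp) (fun {s} hs => h0 s hs) with h | h
  · exact ⟨1, Or.inl rfl, fun s hs => by simpa using h hs⟩
  · exact ⟨-1, Or.inr rfl, fun s hs => by simpa using h hs⟩

theorem hasDerivAt_log_affine {N b x : ℝ} (h : N * x + b ≠ 0) :
    HasDerivAt (fun s => Real.log |N * s + b|) (N / (N * x + b)) x := by
  simp only [Real.log_abs]
  have : HasDerivAt (fun s => N * s + b) N x := by
    simpa using ((hasDerivAt_id x).const_mul N).add_const b
  exact this.log h

theorem hasDerivAt_inv_affine {N b x : ℝ} (K : ℝ) (h : N * x + b ≠ 0) :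
    HasDerivAt (fun s => K / (N * s + b)) (-(K * N) / (N * x + b) ^ 2) x := by
  have : HasDerivAt (fun s => N * s + b) N x := by
    simpa using ((hasDerivAt_id x).const_mul N).add_const b
  refine HasDerivAt.congr_deriv ((this.fun_inv h).const_mul K) ?_
  ring

theorem hasDerivAt_log_of_smooth (hI : IsOpen I) (hF : ContDiffOn ℝ ∞ F I)
    (h0 : ∀ s ∈ I, 0 < F s) {x : ℝ} (hx : x ∈ I) :
    HasDerivAt (fun s => Real.log (F s)) (logDeriv F x) x :=
  (hasDerivAt_of_smooth hI hF hx).log (h0 x hx).ne'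

/-- A positive function with logarithmic derivative `-c / (N s + b)` is a power of `N s + b`. -/
theorem eq_power_of_logDeriv (hI : IsOpen I) (hI' : I.OrdConnected) (hF : ContDiffOn ℝ ∞ F I)
    (h0 : ∀ s ∈ I, 0 < F s) {x₀ : ℝ} (hx₀ : x₀ ∈ I) {N b c : ℝ} (hN : N ≠ 0)
    (hne : ∀ s ∈ I, N * s + b ≠ 0) (h : ∀ s ∈ I, logDeriv F s = -c / (N * s + b)) :
    ∃ C, 0 < C ∧ ∀ s ∈ I, F s = C * |N * s + b| ^ (-(c / N)) := by
  obtain ⟨C, hC⟩ := eqOn_add_const hI hI' hx₀ (F := fun s => Real.log (F s))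
    (fun s hs => hasDerivAt_log_of_smooth hI hF h0 hs)
    (G := fun s => -(c / N) * Real.log |N * s + b|)
    (fun s hs => by
      refine HasDerivAt.congr_deriv ((hasDerivAt_log_affine (hne s hs)).const_mul (-(c / N))) ?_
      rw [h s hs]; field_simp)
  refine ⟨Real.exp C, Real.exp_pos _, fun s hs => ?_⟩
  rw [Real.rpow_def_of_pos (abs_pos.2 (hne s hs)), ← Real.exp_add, ← Real.exp_log (h0 s hs), hC s hs]
  congr 1; ring

/-- The logarithmic derivative of a power of `N s + b`. -/
theorem logDeriv_of_eq_power (hI : IsOpen I) (hF : ContDiffOn ℝ ∞ F I)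
    (h0 : ∀ s ∈ I, 0 < F s) {N b e C : ℝ} (hC : 0 < C)
    (hne : ∀ s ∈ I, N * s + b ≠ 0) (h : ∀ s ∈ I, F s = C * |N * s + b| ^ e) {x : ℝ} (hx : x ∈ I) :
    logDeriv F x = e * N / (N * x + b) := by
  have h1 := hasDerivAt_log_of_smooth hI hF h0 hx
  have h2 : HasDerivAt (fun s => Real.log (F s)) (0 + e * (N / (N * x + b))) x := by
    refine hasDerivAt_congr_on (G := fun s => Real.log C + e * Real.log |N * s + b|) hI ?_ hx
      ((hasDerivAt_const x _).fun_add ((hasDerivAt_log_affine (hne x hx)).const_mul e))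
    intro s hs
    have := abs_pos.2 (hne s hs)
    rw [h s hs, Real.log_mul hC.ne' (Real.rpow_pos_of_pos this _).ne', Real.log_rpow this]
  rw [h1.unique h2]; ring

end Interval

/-! ### Integration of the fiber equations -/

section Fiber

variable {m : ℕ} {θ ζ₀ : ℝ} {J : Set ℝ} {τ u : ℝ → ℝ}

theorem fiberODE_null_iff (hm : 3 ≤ m) (hθ : 0 < θ) (hJ : IsOpen J) (hJ' : J.OrdConnected)
    (hζ₀ : ζ₀ ∈ J) (hτ : ContDiffOn ℝ ∞ τ J) (hu : ContDiffOn ℝ ∞ u J)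
    (hτ0 : ∀ ζ ∈ J, 0 < τ ζ) : FiberODE m θ 0 J τ u ↔ FiberNull m θ J ζ₀ τ u := by
  have hm2 : (0 : ℝ) < (m : ℝ) - 2 := by
    have : (3 : ℝ) ≤ m := by exact_mod_cast hm
    linarith
  constructor
  · intro H
    have h1 : ∀ s ∈ J, ((m : ℝ) - 2) / θ * (deriv (deriv τ) s / τ s) = deriv u s ^ 2 := by
      intro s hs
      rw [deriv_deriv_div hJ hτ hτ0 hs]
      have := (H s hs).1
      field_simp
      linarith
    -- The pointwise sign is that of `u'`, with `+1` at its zeros. The signed root is then `u'`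
    -- itself, hence continuous even where the sign jumps.
    have h2 : ∀ s ∈ J, (if 0 ≤ deriv u s then (1 : ℝ) else -1) *
        √(((m : ℝ) - 2) / θ * (deriv (deriv τ) s / τ s)) = deriv u s := by
      intro s hs
      rw [h1 s hs, Real.sqrt_sq_eq_abs]
      split_ifs with h
      · rw [abs_of_nonneg h, one_mul]
      · rw [abs_of_neg (not_le.1 h)]; ring
    have h3 : ContinuousOn (fun s => (if 0 ≤ deriv u s then (1 : ℝ) else -1) *
        √(((m : ℝ) - 2) / θ * (deriv (deriv τ) s / τ s))) J :=
      (smooth_deriv hJ hu).continuousOn.congr h2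
    obtain ⟨c, hc⟩ := eqOn_add_const hJ hJ' hζ₀
      (fun s hs => by
        have := hasDerivAt_of_smooth hJ hu hs
        rwa [← h2 s hs] at this)
      (fun s hs => hasDerivAt_integral hJ hJ' hζ₀ hs h3)
    refine ⟨fun s hs => ?_, _, c, fun s _ => ?_, h3, hc⟩
    · have h4 := h1 s hs
      have h5 : 0 ≤ ((m : ℝ) - 2) / θ * (deriv (deriv τ) s / τ s) := h4 ▸ sq_nonneg _
      exact nonneg_of_mul_nonneg_right h5 (by positivity)
    · split_ifs <;> simp
  · rintro ⟨h1, σ, c, hσ, hc, hU⟩ s hs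
    refine ⟨?_, zero_mul _, zero_mul _⟩
    have h2 := hasDerivAt_congr_on hJ hU hs
      ((hasDerivAt_integral hJ hJ' hζ₀ hs hc).add_const c)
    rw [h2.deriv, ← deriv_deriv_div hJ hτ hτ0 hs, mul_pow, Real.sq_sqrt]
    · have : σ s ^ 2 = 1 := by rcases hσ s hs with e | e <;> rw [e] <;> norm_num
      rw [this]; field_simp
    · exact mul_nonneg (by positivity) (h1 s hs)

theorem fiberODE_unit_iff (hm : 3 ≤ m) (hθ : 0 < θ) (hJ : IsOpen J) (hJ' : J.OrdConnected)
    (hζ₀ : ζ₀ ∈ J) (hτ : ContDiffOn ℝ ∞ τ J) (hu : ContDiffOn ℝ ∞ u J)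
    (hτ0 : ∀ ζ ∈ J, 0 < τ ζ) (hnc : NonConstOn u J) :
    FiberODE m θ 1 J τ u ↔ FiberUnit m θ J τ u := by
  have hm2 : (0 : ℝ) < (m : ℝ) - 2 := by
    have : (3 : ℝ) ≤ m := by exact_mod_cast hm
    linarith
  have hR : (0 : ℝ) < 2 - 3 * m + (m : ℝ) ^ 2 := by nlinarith
  have hsm := smooth_logDeriv hJ hτ hτ0
  have hdu := smooth_deriv hJ hu
  have hsq : √θ ^ 2 = θ := Real.sq_sqrt hθ.le
  have hsq2 : √(2 - 3 * m + (m : ℝ) ^ 2) ^ 2 = 2 - 3 * m + (m : ℝ) ^ 2 := Real.sq_sqrt hR.le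
  have hsq0 : 0 < √θ := Real.sqrt_pos.2 hθ
  -- the expression for the map in terms of the sign of the affine function
  have key : ∀ {s L l : ℝ}, (s = 1 ∨ s = -1) → L ≠ 0 → |L| = s * L →
      √(2 - 3 * (m : ℝ) + (m : ℝ) ^ 2) * L * l / (((m : ℝ) - 2) * √(θ * L ^ 2)) =
      s * (√(2 - 3 * (m : ℝ) + (m : ℝ) ^ 2) / (((m : ℝ) - 2) * √θ)) * l := by
    intro s L l hs hL h
    rw [Real.sqrt_mul hθ.le, Real.sqrt_sq_eq_abs, h]
    rcases hs with e | e <;> subst e <;> field_simp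
  constructor
  · intro H
    -- `u'` solves a linear equation, so one zero would force `u' = 0` throughout and `u` would be
    -- constant. It follows that `τ'/τ` has no zeros either, since at one the first two equations
    -- would give `θ u'² = 0`.
    have hu0 : ∀ s ∈ J, deriv u s ≠ 0 := by
      intro s hs h0
      obtain ⟨x, hx, y, hy, hxy⟩ := hnc
      refine hxy (eq_of_hasDerivAt_zero hJ hJ' (fun r hr => ?_) hx hy)
      have h1 := hasDerivAt_of_smooth hJ hu hr
      rwa [eq_zero_of_linear_ode hJ hJ' (hsm.continuousOn.const_mul ((m : ℝ) - 2))
        (fun r hr => by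
          have := hasDerivAt_of_smooth hJ hdu hr
          rwa [show deriv (deriv u) r = (m - 2) * logDeriv τ r * deriv u r by
            linarith [(H r hr).2.2]] at this) hs h0 hr] at h1
    have ht0 : ∀ s ∈ J, logDeriv τ s ≠ 0 := by
      intro s hs h0
      obtain ⟨h1, h2, -⟩ := H s hs
      rw [h0] at h1 h2
      have : deriv (logDeriv τ) s = 0 := by linarith
      rw [this] at h1
      have h3 : 0 < θ * deriv u s ^ 2 := by
        have := hu0 s hs
        positivity
      linarith
    obtain ⟨c₁, hc₁⟩ := eqOn_add_const hJ hJ' hζ₀ (F := fun s => -(logDeriv τ s)⁻¹)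
      (G := fun s => ((m : ℝ) - 2) * s) (a := fun _ => (m : ℝ) - 2)
      (fun s hs => by
        have h := ht0 s hs
        refine HasDerivAt.congr_deriv (((hasDerivAt_of_smooth hJ hsm hs).fun_inv h).fun_neg) ?_
        have : deriv (logDeriv τ) s = (m - 2) * logDeriv τ s ^ 2 := by linarith [(H s hs).2.1]
        rw [this]; field_simp)
      (fun s _ => by simpa using (hasDerivAt_id s).const_mul ((m : ℝ) - 2))
    have hl0 : ∀ s ∈ J, ((m : ℝ) - 2) * s + c₁ ≠ 0 := fun s hs => by
      rw [← hc₁ s hs]; simpa using ht0 s hs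
    have ht : ∀ s ∈ J, logDeriv τ s = -1 / (((m : ℝ) - 2) * s + c₁) := fun s hs => by
      rw [← hc₁ s hs]
      have := ht0 s hs
      field_simp
    obtain ⟨c₂, hc₂, hτe⟩ := eq_power_of_logDeriv hJ hJ' hτ hτ0 hζ₀ hm2.ne' hl0 ht
    obtain ⟨K, hK⟩ : ∃ K, ∀ s ∈ J, deriv u s * (((m : ℝ) - 2) * s + c₁) = K := by
      refine ⟨_, fun s hs => eq_of_hasDerivAt_zero (x := s) (y := ζ₀)
        (F := fun s => deriv u s * (((m : ℝ) - 2) * s + c₁)) hJ hJ' (fun r hr => ?_) hs hζ₀⟩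
      have h1 : HasDerivAt (fun s => ((m : ℝ) - 2) * s + c₁) ((m : ℝ) - 2) r := by
        simpa using ((hasDerivAt_id r).const_mul ((m : ℝ) - 2)).add_const c₁
      refine HasDerivAt.congr_deriv ((hasDerivAt_of_smooth hJ hdu hr).fun_mul h1) ?_
      have h2 := (H r hr).2.2
      have h3 := hl0 r hr
      rw [show deriv (deriv u) r = (m - 2) * logDeriv τ r * deriv u r by linarith, ht r hr]
      field_simp
      ring
    have hK' : ∀ s ∈ J, deriv u s = K / (((m : ℝ) - 2) * s + c₁) := fun s hs => by
      rw [← hK s hs]; field_simp [hl0 s hs]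
    -- At the one point `ζ₀`, inserting `t' = (m-2)t²` into the first equation gives `(m-2)(m-1) t²
    -- = θ u'²`, and `(m-2)(m-1) = 2 - 3m + m²`.
    have hK2 : (K * √θ) ^ 2 = √(2 - 3 * (m : ℝ) + (m : ℝ) ^ 2) ^ 2 := by
      obtain ⟨h1, h2, -⟩ := H ζ₀ hζ₀
      have h3 : deriv (logDeriv τ) ζ₀ = (m - 2) * logDeriv τ ζ₀ ^ 2 := by linarith
      have h4 := hl0 ζ₀ hζ₀
      rw [h3, ht ζ₀ hζ₀, hK' ζ₀ hζ₀] at h1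
      rw [mul_pow, hsq, hsq2]
      field_simp at h1
      linarith
    obtain ⟨c₃, hc₃⟩ := eqOn_add_const hJ hJ' hζ₀ (F := u)
      (G := fun s => K / ((m : ℝ) - 2) * Real.log |((m : ℝ) - 2) * s + c₁|)
      (fun s hs => hasDerivAt_of_smooth hJ hu hs)
      (fun s hs => by
        refine HasDerivAt.congr_deriv
          ((hasDerivAt_log_affine (hl0 s hs)).const_mul (K / ((m : ℝ) - 2))) ?_
        rw [hK' s hs]; field_simp)
    obtain ⟨s₀, hs₀, habs⟩ := abs_eq_sign_mul (F := fun s => ((m : ℝ) - 2) * s + c₁) hJ'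
      (by fun_prop) hl0
    have hs₀2 : s₀ * s₀ = 1 := by rcases hs₀ with e | e <;> rw [e] <;> norm_num
    obtain ⟨σ, hσ, hKσ⟩ : ∃ σ : ℝ, (σ = 1 ∨ σ = -1) ∧
        K * √θ = σ * √(2 - 3 * (m : ℝ) + (m : ℝ) ^ 2) := by
      rcases sq_eq_sq_iff_eq_or_eq_neg.1 hK2 with h | h
      · exact ⟨1, Or.inl rfl, by rw [h]; ring⟩
      · exact ⟨-1, Or.inr rfl, by rw [h]; ring⟩
    -- The target formula contains `ℓ / |ℓ|`, which is the constant sign `s₀`. The sign `σ` of `K`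
    -- is multiplied by `s₀` to compensate, as `s₀² = 1`.
    refine ⟨c₁, c₂, c₃, σ * s₀, hc₂, ?_, fun ζ hζ => ⟨hl0 ζ hζ, ?_, ?_⟩⟩
    · rcases hσ with e | e <;> rcases hs₀ with e' | e' <;> rw [e, e'] <;> norm_num
    · rw [hτe ζ hζ]
      congr 2
      rw [← neg_sub (m : ℝ) 2, div_neg]
    · rw [hc₃ ζ hζ, key hs₀ (hl0 ζ hζ) (habs ζ hζ)]
      have : K = σ * √(2 - 3 * (m : ℝ) + (m : ℝ) ^ 2) / √θ := by
        rw [← hKσ]; field_simp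
      rw [this]
      field_simp
      linear_combination -(σ * Real.log |((m : ℝ) - 2) * ζ + c₁| *
        √(2 - 3 * (m : ℝ) + (m : ℝ) ^ 2)) * hs₀2
  · rintro ⟨c₁, c₂, c₃, σ, hc₂, hσ, H⟩
    have hl0 := fun s hs => (H s hs).1
    have ht : ∀ s ∈ J, logDeriv τ s = -1 / (((m : ℝ) - 2) * s + c₁) := fun s hs => by
      rw [logDeriv_of_eq_power hJ hτ hτ0 hc₂ hl0 (fun s hs => (H s hs).2.1) hs,
        ← neg_sub (m : ℝ) 2]
      have := hl0 s hs
      field_simp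
    obtain ⟨s₀, hs₀, habs⟩ := abs_eq_sign_mul (F := fun s => ((m : ℝ) - 2) * s + c₁) hJ'
      (by fun_prop) hl0
    obtain ⟨R, hRdef⟩ : ∃ R, R = √(2 - 3 * (m : ℝ) + (m : ℝ) ^ 2) := ⟨_, rfl⟩
    have hu' : ∀ s ∈ J, deriv u s = σ * s₀ * R / √θ / (((m : ℝ) - 2) * s + c₁) := by
      intro s hs
      refine (hasDerivAt_congr_on (G := fun s => c₃ + σ * s₀ * R / (((m : ℝ) - 2) * √θ) *
        Real.log |((m : ℝ) - 2) * s + c₁|) hJ (fun r hr => ?_) hs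
        (((hasDerivAt_log_affine (hl0 s hs)).const_mul _).const_add c₃)).deriv.trans ?_
      · rw [(H r hr).2.2, key hs₀ (hl0 r hr) (habs r hr), hRdef]; ring
      · field_simp
    intro s hs
    have hl := hl0 s hs
    have ht' := (hasDerivAt_congr_on hJ ht hs (hasDerivAt_inv_affine (-1) hl)).deriv
    have hu'' := (hasDerivAt_congr_on hJ hu' hs (hasDerivAt_inv_affine _ hl)).deriv
    have hσ2 : σ ^ 2 = 1 := by rcases hσ with e | e <;> rw [e] <;> norm_num
    have hs2 : s₀ ^ 2 = 1 := by rcases hs₀ with e | e <;> rw [e] <;> norm_num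
    refine ⟨?_, ?_, ?_⟩
    · rw [ht', ht s hs, hu' s hs, div_pow _ (((m : ℝ) - 2) * s + c₁),
        div_pow _ (((m : ℝ) - 2) * s + c₁), div_pow _ √θ, mul_pow, mul_pow, hσ2, hs2, hRdef, hsq,
        hsq2]
      field_simp
      ring
    · rw [ht', ht s hs]; field_simp; ring
    · rw [hu'', ht s hs, hu' s hs]; field_simp; ring

end Fiber

/-! ### Integration of the base equations -/

section Base

variable {n m : ℕ} {ξ₀ : ℝ} {I : Set ℝ} {φ f h : ℝ → ℝ}

theorem baseODE_null_iff (hI : IsOpen I) (hI' : I.OrdConnected)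
    (hξ₀ : ξ₀ ∈ I) (hφ : ContDiffOn ℝ ∞ φ I) (hf : ContDiffOn ℝ ∞ f I) (hh : ContDiffOn ℝ ∞ h I)
    (hφ0 : ∀ ξ ∈ I, 0 < φ ξ) (hf0 : ∀ ξ ∈ I, 0 < f ξ) :
    BaseODE n m 0 I φ f h ↔ BaseNull n m I ξ₀ φ f h := by
  unfold BaseNull
  obtain ⟨E, hE⟩ : ∃ E : ℝ → ℝ, E = fun r => (m : ℝ) * (deriv (deriv f) r / f r) * φ r ^ 2
          + 2 * m * φ r * deriv φ r * (deriv f r / f r)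
          - ((n : ℝ) - 2) * φ r * deriv (deriv φ) r := ⟨_, rfl⟩
  have hdφ := smooth_deriv hI hφ
  have hdf := smooth_deriv hI hf
  have hdh := smooth_deriv hI hh
  have hEc : ContinuousOn E I := by
    have c1 := hφ.continuousOn
    have c2 := hf.continuousOn
    have c3 := hdφ.continuousOn
    have c4 := hdf.continuousOn
    have c5 := (smooth_deriv hI hdφ).continuousOn
    have c6 := (smooth_deriv hI hdf).continuousOn
    have c0 : ∀ s ∈ I, f s ≠ 0 := fun s hs => (hf0 s hs).ne'
    rw [hE]
    fun_prop (disch := assumption)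
  have hE' : ∀ s ∈ I, E s = φ s ^ 2 * (m * (deriv (logDeriv f) s + logDeriv f s ^ 2
      + 2 * logDeriv φ s * logDeriv f s)
      - ((n : ℝ) - 2) * (deriv (logDeriv φ) s + logDeriv φ s ^ 2)) := by
    intro s hs
    rw [← deriv_deriv_div hI hf hf0 hs, ← deriv_deriv_div hI hφ hφ0 hs, logDeriv_apply,
      logDeriv_apply, hE]
    have h1 := (hφ0 s hs).ne'
    have h2 := (hf0 s hs).ne'
    field_simp
  -- The integrating factor `φ²` turns the only remaining equation into `(φ² h')' = E`; this is the
  -- origin of the double integral.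
  have hdd : ∀ s ∈ I, HasDerivAt (fun s => φ s ^ 2 * deriv h s)
      (φ s ^ 2 * (deriv (deriv h) s + 2 * logDeriv φ s * deriv h s)) s := by
    intro s hs
    refine HasDerivAt.congr_deriv (((hasDerivAt_of_smooth hI hφ hs).fun_pow 2).fun_mul
      (hasDerivAt_of_smooth hI hdh hs)) ?_
    have h1 := (hφ0 s hs).ne'
    rw [logDeriv_apply]
    field_simp
    push_cast
    ring
  have hint : ∀ c₁ : ℝ, ContinuousOn (fun s => (φ s ^ 2)⁻¹ * ((∫ r in ξ₀..s, E r) + c₁)) I := by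
    intro c₁ s hs
    refine ContinuousAt.continuousWithinAt ?_
    have c1 := (hasDerivAt_of_smooth hI hφ hs).continuousAt
    exact ((c1.pow 2).inv₀ (pow_ne_zero _ (hφ0 s hs).ne')).mul
      ((hasDerivAt_integral hI hI' hξ₀ hs hEc).continuousAt.add continuousAt_const)
  have hmain : BaseODE n m 0 I φ f h ↔ ∀ s ∈ I,
      φ s ^ 2 * (deriv (deriv h) s + 2 * logDeriv φ s * deriv h s) = E s := by
    refine forall₂_congr fun s hs => ?_
    have h1 : φ s ^ 2 ≠ 0 := pow_ne_zero _ (hφ0 s hs).ne'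
    rw [hE' s hs, mul_right_inj' h1]
    constructor
    · rintro ⟨h2, -⟩; linarith
    · exact fun h2 => ⟨by linarith, zero_mul _, zero_mul _⟩
  rw [hmain]
  have hE2 : ∀ r, E r = _ := fun r => congrFun hE r
  simp only [← hE2]
  constructor
  · intro H
    obtain ⟨c₁, hc₁⟩ := eqOn_add_const hI hI' hξ₀ hdd
      (fun s hs => by
        have := hasDerivAt_integral hI hI' hξ₀ hs hEc
        rwa [← H s hs] at this)
    obtain ⟨c₂, hc₂⟩ := eqOn_add_const hI hI' hξ₀
      (fun s hs => by
        have h1 := hasDerivAt_of_smooth hI hh hs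
        rwa [show deriv h s = (φ s ^ 2)⁻¹ * ((∫ r in ξ₀..s, E r) + c₁) by
          rw [← hc₁ s hs]; field_simp [(hφ0 s hs).ne']] at h1)
      (fun s hs => hasDerivAt_integral hI hI' hξ₀ hs (hint c₁))
    exact ⟨c₁, c₂, hc₂⟩
  · rintro ⟨c₁, c₂, H⟩ s hs
    have h1 : ∀ s ∈ I, φ s ^ 2 * deriv h s = (∫ r in ξ₀..s, E r) + c₁ := by
      intro s hs
      rw [(hasDerivAt_congr_on hI H hs
        ((hasDerivAt_integral hI hI' hξ₀ hs (hint c₁)).add_const c₂)).deriv]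
      field_simp [(hφ0 s hs).ne']
    exact (hdd s hs).unique (hasDerivAt_congr_on hI h1 hs
      ((hasDerivAt_integral hI hI' hξ₀ hs hEc).add_const c₁))

theorem rootD_sq (k : ℝ) (hn : 1 < n) : rootD n m k ^ 2 = m + k ^ 2 * ((n : ℝ) - 1) := by
  have : (1 : ℝ) < n := by exact_mod_cast hn
  exact Real.sq_sqrt (by have := sub_pos.2 this; positivity)

/-- Since `n ≥ 2` and `m > 0`, `k² < m + k²(n-1)`. Consequently `N₊ > 0 > N₋`, and division by `N`
is legitimate. -/
theorem abs_lt_rootD (k : ℝ) (hn : 1 < n) (hm : 3 ≤ m) : |k| < rootD n m k := by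
  have h1 : (2 : ℝ) ≤ n := by exact_mod_cast hn
  have h2 : (3 : ℝ) ≤ m := by exact_mod_cast hm
  refine Real.lt_sqrt_of_sq_lt ?_
  rw [sq_abs]
  nlinarith [sq_nonneg k]

/-- Lowering both exponents by one identifies the stated formula for `z'` with `-ψ (z+k-D)(z+k+D)`.
-/
theorem signedPow_eq {x : ℝ} (hx : x ≠ 0) (p : ℝ) : signedPow x p = x * |x| ^ (p - 1) := by
  have h := abs_pos.2 hx
  rw [signedPow, Real.rpow_sub_one h.ne', mul_div_assoc', eq_div_iff h.ne']
  have : Real.sign x * |x| = x := by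
    rcases lt_or_gt_of_ne hx with h | h
    · rw [Real.sign_of_neg h, abs_of_neg h]; ring
    · rw [Real.sign_of_pos h, abs_of_pos h]; ring
  linear_combination |x| ^ p * this

/-- The derivative of `(a-1)/2 log|A| + (-a-1)/2 log|B|` along `z' = -q A B`, where
`A = z + k - D`, `B = z + k + D` and `a = k / D`. -/
theorem hasDerivAt_log_system {z : ℝ → ℝ} {k D q s : ℝ} (hD : D ≠ 0)
    (hA : z s + k - D ≠ 0) (hB : z s + k + D ≠ 0)
    (hz : HasDerivAt z (-q * (z s + k - D) * (z s + k + D)) s) :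
    HasDerivAt (fun s => Real.log |z s + k - D| * ((k / D - 1) / 2)
      + Real.log |z s + k + D| * ((-(k / D) - 1) / 2)) (z s * q) s := by
  simp only [Real.log_abs]
  have h1 : HasDerivAt (fun s => z s + k - D) _ s := (hz.add_const k).sub_const D
  have h2 : HasDerivAt (fun s => z s + k + D) _ s := (hz.add_const k).add_const D
  -- The exponents come from partial fractions: `(a-1)/2 · B - (a+1)/2 · A = -(z+k) + a D`, and `a D
  -- = k` reduces this to `-z`.
  refine HasDerivAt.congr_deriv (((h1.log hA).mul_const ((k / D - 1) / 2)).fun_add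
    ((h2.log hB).mul_const ((-(k / D) - 1) / 2))) ?_
  field_simp
  ring

theorem exp_log_system {A B : ℝ} (hA : A ≠ 0) (hB : B ≠ 0) (a b : ℝ) :
    Real.exp (Real.log |A| * a + Real.log |B| * b) = |A| ^ a * |B| ^ b := by
  rw [Real.exp_add, Real.rpow_def_of_pos (abs_pos.2 hA), Real.rpow_def_of_pos (abs_pos.2 hB)]

theorem baseODE_of_unit (hn : 1 < n) (hm : 3 ≤ m) (hI : IsOpen I)
    (hφ : ContDiffOn ℝ ∞ φ I) (hf : ContDiffOn ℝ ∞ f I)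
    (hφ0 : ∀ ξ ∈ I, 0 < φ ξ) (hf0 : ∀ ξ ∈ I, 0 < f ξ) (H : BaseUnit n m I φ f h) :
    BaseODE n m 1 I φ f h := by
  obtain ⟨k, z, hz, hkz, hcase⟩ := H
  have hD2 := rootD_sq (n := n) (m := m) k hn
  have hDk := abs_lt_rootD k hn hm
  have hD0 : 0 < rootD n m k := (abs_nonneg k).trans_lt hDk
  obtain ⟨D, hD⟩ : ∃ D, D = rootD n m k := ⟨_, rfl⟩
  -- reduction to a first order system
  suffices hsys : ∃ y : ℝ → ℝ, ∀ s ∈ I, logDeriv φ s = k * logDeriv f s ∧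
      deriv h s = (y s + m - k * ((n : ℝ) - 2)) * logDeriv f s ∧
      HasDerivAt (logDeriv f) (y s * logDeriv f s ^ 2) s ∧
      HasDerivAt y (-logDeriv f s * (y s + k - D) * (y s + k + D)) s by
    obtain ⟨y, hy⟩ := hsys
    intro s hs
    obtain ⟨h1, h2, h3, h4⟩ := hy s hs
    have h5 := (hasDerivAt_congr_on hI (fun s hs => (hy s hs).1) hs (h3.const_mul k)).deriv
    have h6 := (hasDerivAt_congr_on hI (fun s hs => (hy s hs).2.1) hs
      (((h4.add_const (m : ℝ)).sub_const (k * ((n : ℝ) - 2))).fun_mul h3)).deriv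
    rw [h5, h6, h3.deriv, h1, h2]
    rw [← hD] at hD2
    refine ⟨?_, ?_, ?_⟩
    -- After substitution everything cancels except `(f'/f)² (D² - m - k²(n-1))`, which is why `D`
    -- is defined as it is.
    · linear_combination logDeriv f s ^ 2 * hD2
    · ring
    · ring
  rcases hcase with ⟨-, N, c₄, c₅, c₇, b, hN, hc₄, hc₅, H⟩ | ⟨-, a, c₆, ψ, ha, H⟩
  · have hN0 : N ≠ 0 := by
      have := abs_lt.1 hDk
      rcases hN with e | e
      · rw [e]; exact ne_of_gt (by linarith)
      · rw [e]; exact ne_of_lt (by linarith)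
    have hl0 := fun s hs => (H s hs).1
    have e1 : ∀ s ∈ I, logDeriv f s = -1 / (N * s + b) := by
      intro s hs
      rw [logDeriv_of_eq_power (e := -(1 / N)) hI hf hf0 hc₅ hl0 (fun s hs => by
        rw [(H s hs).2.2.1, Real.rpow_neg (abs_nonneg _), div_eq_mul_inv]) hs]
      field_simp
    have e2 : ∀ s ∈ I, logDeriv φ s = k * logDeriv f s := by
      intro s hs
      rw [logDeriv_of_eq_power (e := -(k / N)) hI hφ hφ0 hc₄ hl0 (fun s hs => by
        rw [(H s hs).2.1, Real.rpow_neg (abs_nonneg _), div_eq_mul_inv]) hs, e1 s hs]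
      field_simp
    -- Power laws correspond to the equilibria `y = N₊` and `y = N₋`, where one factor of the
    -- equation for `y` vanishes.
    refine ⟨fun _ => N, fun s hs => ⟨e2 s hs, ?_, ?_, ?_⟩⟩
    · rw [(hasDerivAt_congr_on hI (fun s hs => (H s hs).2.2.2) hs
        (((hasDerivAt_log_affine (hl0 s hs)).const_mul _).add_const c₇)).deriv, e1 s hs]
      have := hl0 s hs
      field_simp
      ring
    · have := hl0 s hs
      refine HasDerivAt.congr_deriv (hasDerivAt_congr_on hI e1 hs (hasDerivAt_inv_affine (-1) this)) ?_
      rw [e1 s hs]; field_simp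
    · refine HasDerivAt.congr_deriv (hasDerivAt_const s N) ?_
      rw [hD]
      rcases hN with e | e <;> rw [e] <;> ring
  · rw [← hD] at H ha hD0
    refine ⟨z, fun s hs => ?_⟩
    obtain ⟨h1, h2, h3, hA, hB, -, -⟩ := H s hs
    have hq : ∀ s ∈ I, logDeriv f s = c₆ * Real.exp (Real.log |z s + k - D| * ((k / D - 1) / 2)
        + Real.log |z s + k + D| * ((-(k / D) - 1) / 2)) := by
      intro s hs
      obtain ⟨-, h2, -, hA, hB, h6, -⟩ := H s hs
      rw [logDeriv_apply, h2, h6, exp_log_system hA hB, ha, mul_assoc]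
    have hz' : HasDerivAt z (-logDeriv f s * (z s + k - D) * (z s + k + D)) s := by
      refine HasDerivAt.congr_deriv (hasDerivAt_of_smooth hI hz hs) ?_
      rw [(H s hs).2.2.2.2.2.2, signedPow_eq hA, signedPow_eq hB, hq s hs, exp_log_system hA hB,
        show (a + 1) / 2 - 1 = (k / D - 1) / 2 by rw [ha]; ring,
        show (-a + 1) / 2 - 1 = (-(k / D) - 1) / 2 by rw [ha]; ring]
      ring
    refine ⟨by rw [logDeriv_apply, logDeriv_apply, h1], by rw [h3, logDeriv_apply, h2], ?_, hz'⟩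
    refine HasDerivAt.congr_deriv (hasDerivAt_congr_on hI hq hs
      ((hasDerivAt_log_system hD0.ne' hA hB hz').exp.const_mul c₆)) ?_
    rw [← mul_assoc, ← hq s hs]; ring

theorem unit_of_baseODE (hn : 1 < n) (hm : 3 ≤ m) (hI : IsOpen I) (hI' : I.OrdConnected)
    (hξ₀ : ξ₀ ∈ I)
    (hφ : ContDiffOn ℝ ∞ φ I) (hf : ContDiffOn ℝ ∞ f I) (hh : ContDiffOn ℝ ∞ h I)
    (hφ0 : ∀ ξ ∈ I, 0 < φ ξ) (hf0 : ∀ ξ ∈ I, 0 < f ξ) (hnc : NonConstOn f I)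
    (H : BaseODE n m 1 I φ f h) : BaseUnit n m I φ f h := by
  have hp := smooth_logDeriv hI hφ hφ0
  have hq := smooth_logDeriv hI hf hf0
  have hdh := smooth_deriv hI hh
  obtain ⟨w, hw⟩ : ∃ w : ℝ → ℝ, w = fun s => ((n : ℝ) - 2) * logDeriv φ s - m * logDeriv f s
    + deriv h s := ⟨_, rfl⟩
  have hws : ContDiffOn ℝ ∞ w I := by
    rw [hw]
    exact ((contDiffOn_const.mul hp).sub (contDiffOn_const.mul hq)).add hdh
  have hw' : ∀ s, w s = ((n : ℝ) - 2) * logDeriv φ s - m * logDeriv f s + deriv h s :=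
    fun s => congrFun hw s
  have dp : ∀ s ∈ I, HasDerivAt (logDeriv φ) (w s * logDeriv φ s) s := fun s hs => by
    refine HasDerivAt.congr_deriv (hasDerivAt_of_smooth hI hp hs) ?_
    rw [hw']; linarith [(H s hs).2.1]
  have dq : ∀ s ∈ I, HasDerivAt (logDeriv f) (w s * logDeriv f s) s := fun s hs => by
    refine HasDerivAt.congr_deriv (hasDerivAt_of_smooth hI hq hs) ?_
    rw [hw']; linarith [(H s hs).2.2]
  have q0 : ∀ s ∈ I, logDeriv f s ≠ 0 := by
    intro s hs h0
    obtain ⟨x, hx, y, hy, hxy⟩ := hnc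
    refine hxy (eq_of_hasDerivAt_zero hI hI' (fun r hr => ?_) hx hy)
    have h1 := hasDerivAt_of_smooth hI hf hr
    have h2 := eq_zero_of_linear_ode hI hI' hws.continuousOn dq hs h0 hr
    rw [logDeriv_apply, div_eq_zero_iff] at h2
    rwa [h2.resolve_right (hf0 r hr).ne'] at h1
  -- Numerator and denominator solve the same linear equation with coefficient `w`, so their ratio
  -- is constant.
  obtain ⟨k, hk⟩ : ∃ k, ∀ s ∈ I, logDeriv φ s / logDeriv f s = k := by
    refine ⟨_, fun s hs => eq_of_hasDerivAt_zero (x := s) (y := ξ₀)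
      (F := fun s => logDeriv φ s / logDeriv f s) hI hI' (fun r hr => ?_) hs hξ₀⟩
    refine HasDerivAt.congr_deriv ((dp r hr).fun_div (dq r hr) (q0 r hr)) ?_
    ring
  have hk' : ∀ s ∈ I, logDeriv φ s = k * logDeriv f s := fun s hs => by
    rw [← hk s hs]; field_simp [q0 s hs]
  obtain ⟨z, hz⟩ : ∃ z : ℝ → ℝ, z = fun s => w s / logDeriv f s := ⟨_, rfl⟩
  have hzs : ContDiffOn ℝ ∞ z I := by rw [hz]; exact hws.div hq q0
  have hwz : ∀ s ∈ I, w s = z s * logDeriv f s := fun s hs => by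
    rw [hz]; field_simp [q0 s hs]
  have hh' : ∀ s ∈ I, deriv h s = (z s + m - k * ((n : ℝ) - 2)) * logDeriv f s := fun s hs => by
    have := hw' s
    rw [hk' s hs, hwz s hs] at this
    linarith
  have hD2 := rootD_sq (n := n) (m := m) k hn
  have hDk := abs_lt_rootD k hn hm
  have hD0 : 0 < rootD n m k := (abs_nonneg k).trans_lt hDk
  obtain ⟨D, hD⟩ : ∃ D, D = rootD n m k := ⟨_, rfl⟩
  rw [← hD] at hD2 hDk hD0
  -- Differentiating the expression for `h'` and inserting it in the first base equation determines
  -- `z' f'/f`; the factor `f'/f` is nonzero and cancels.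
  have dz : ∀ s ∈ I, HasDerivAt z (-logDeriv f s * (z s + k - D) * (z s + k + D)) s := by
    intro s hs
    have h1 := hasDerivAt_of_smooth hI hzs hs
    have h2 := (hasDerivAt_congr_on hI hh' hs
      (((h1.add_const (m : ℝ)).sub_const (k * ((n : ℝ) - 2))).fun_mul (dq s hs))).deriv
    have h3 := (H s hs).1
    rw [(dp s hs).deriv, (dq s hs).deriv, h2, hh' s hs, hk' s hs, hwz s hs] at h3
    refine HasDerivAt.congr_deriv (h1) ?_
    refine mul_right_cancel₀ (q0 s hs) ?_
    linear_combination h3 - logDeriv f s ^ 2 * hD2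
  refine ⟨k, z, hzs, fun s hs => ⟨?_, ?_⟩, ?_⟩
  · rw [← logDeriv_apply, ← logDeriv_apply, hk' s hs]
  · rw [← logDeriv_apply, hh' s hs]; ring
  -- a zero of `z + k - D` or `z + k + D` forces `z` to be constant
  have dA : ∀ E : ℝ, ∀ s ∈ I, HasDerivAt (fun s => z s + k + E)
      (-logDeriv f s * (z s + k - D) * (z s + k + D)) s := fun E s hs =>
    ((dz s hs).add_const k).add_const E
  have cz := hzs.continuousOn
  have cq := hq.continuousOn
  have power : ∀ N : ℝ, (N = -k + D ∨ N = -k - D) → (∀ s ∈ I, z s = N) →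
      ((∃ z₀ : ℝ, z₀ ≠ 0 ∧ ∀ ξ ∈ I, z ξ = z₀) ∧ BasePower n m k I φ f h) := by
    intro N hN hzN
    have hN0 : N ≠ 0 := by
      have := abs_lt.1 hDk
      rcases hN with e | e
      · rw [e]; exact ne_of_gt (by linarith)
      · rw [e]; exact ne_of_lt (by linarith)
    refine ⟨⟨N, hN0, hzN⟩, ?_⟩
    -- From `q' = N q²` one gets `(-1/q)' = N`, so `-1/q = N ξ + b`; nonvanishing of the affine
    -- function comes for free.
    obtain ⟨b, hb⟩ := eqOn_add_const hI hI' hξ₀ (F := fun s => -(logDeriv f s)⁻¹)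
      (G := fun s => N * s) (a := fun _ => N)
      (fun s hs => by
        refine HasDerivAt.congr_deriv (((dq s hs).fun_inv (q0 s hs)).fun_neg) ?_
        have := q0 s hs
        rw [hwz s hs, hzN s hs]; field_simp)
      (fun s _ => by simpa using (hasDerivAt_id s).const_mul N)
    have hl0 : ∀ s ∈ I, N * s + b ≠ 0 := fun s hs => by
      rw [← hb s hs]; simpa using q0 s hs
    have hqe : ∀ s ∈ I, logDeriv f s = -1 / (N * s + b) := fun s hs => by
      rw [← hb s hs]
      have := q0 s hs
      field_simp
    obtain ⟨c₅, hc₅, hfe⟩ := eq_power_of_logDeriv hI hI' hf hf0 hξ₀ hN0 hl0 hqe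
    obtain ⟨c₄, hc₄, hφe⟩ := eq_power_of_logDeriv (c := k) hI hI' hφ hφ0 hξ₀ hN0 hl0
      (fun s hs => by rw [hk' s hs, hqe s hs]; ring)
    obtain ⟨c₇, hc₇⟩ := eqOn_add_const hI hI' hξ₀ (F := h)
      (G := fun s => -(((m : ℝ) - ((n : ℝ) - 2) * k + N) / N) * Real.log |N * s + b|)
      (fun s hs => hasDerivAt_of_smooth hI hh hs)
      (fun s hs => by
        refine HasDerivAt.congr_deriv ((hasDerivAt_log_affine (hl0 s hs)).const_mul _) ?_
        have := hl0 s hs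
        rw [hh' s hs, hqe s hs, hzN s hs]; field_simp; ring)
    refine ⟨N, c₄, c₅, c₇, b, hD ▸ hN, hc₄, hc₅, fun s hs => ⟨hl0 s hs, ?_, ?_, hc₇ s hs⟩⟩
    · rw [hφe s hs, Real.rpow_neg (abs_nonneg _), ← div_eq_mul_inv]
    · rw [hfe s hs, Real.rpow_neg (abs_nonneg _), ← div_eq_mul_inv]
  by_cases hA : ∃ s ∈ I, z s + k + -D = 0
  · obtain ⟨s, hs, h0⟩ := hA
    refine Or.inl (power (-k + D) (Or.inl rfl) fun r hr => ?_)
    have : z r + k + -D = 0 := eq_zero_of_linear_ode (F := fun s => z s + k + -D)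
      (a := fun s => -logDeriv f s * (z s + k + D)) hI hI' (by fun_prop)
      (fun r hr => by refine HasDerivAt.congr_deriv (dA (-D) r hr) ?_; ring) hs h0 hr
    linarith
  by_cases hB : ∃ s ∈ I, z s + k + D = 0
  · obtain ⟨s, hs, h0⟩ := hB
    refine Or.inl (power (-k - D) (Or.inr rfl) fun r hr => ?_)
    have : z r + k + D = 0 := eq_zero_of_linear_ode (F := fun s => z s + k + D)
      (a := fun s => -logDeriv f s * (z s + k - D)) hI hI' (by fun_prop)
      (fun r hr => dA D r hr) hs h0 hr
    linarith
  push Not at hA hB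
  have hA : ∀ s ∈ I, z s + k - D ≠ 0 := hA
  refine Or.inr ⟨?_, ?_⟩
  -- If `z` were constant its derivative would vanish, but all three factors in the equation for
  -- `z'` are nonzero.
  · by_contra hcon
    have hcon : ∀ x ∈ I, ∀ y ∈ I, z x = z y := by
      simpa [NonConstOn] using hcon
    have h1 := hasDerivAt_congr_on hI (fun s hs => hcon s hs ξ₀ hξ₀) hξ₀
      (hasDerivAt_const ξ₀ (z ξ₀))
    have h2 := (dz ξ₀ hξ₀).unique h1
    simp [q0 ξ₀ hξ₀, hA ξ₀ hξ₀, hB ξ₀ hξ₀] at h2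
  -- A first integral: `f'/f` and the product of powers both have logarithmic derivative `z f'/f`,
  -- so their quotient is the constant `c₆`.
  · obtain ⟨c₆, hc₆⟩ : ∃ c, ∀ s ∈ I, logDeriv f s *
        Real.exp (-(Real.log |z s + k - D| * ((k / D - 1) / 2)
          + Real.log |z s + k + D| * ((-(k / D) - 1) / 2))) = c := by
      refine ⟨_, fun s hs => eq_of_hasDerivAt_zero (x := s) (y := ξ₀)
        (F := fun s => logDeriv f s * Real.exp (-(Real.log |z s + k - D| * ((k / D - 1) / 2)
          + Real.log |z s + k + D| * ((-(k / D) - 1) / 2)))) hI hI' (fun r hr => ?_) hs hξ₀⟩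
      refine HasDerivAt.congr_deriv ((dq r hr).fun_mul
        (hasDerivAt_log_system hD0.ne' (hA r hr) (hB r hr) (dz r hr)).fun_neg.exp) ?_
      rw [hwz r hr]; ring
    have hqe : ∀ s ∈ I, logDeriv f s = c₆ * |z s + k - D| ^ ((k / D - 1) / 2)
        * |z s + k + D| ^ ((-(k / D) - 1) / 2) := by
      intro s hs
      rw [mul_assoc, ← exp_log_system (hA s hs) (hB s hs), ← hc₆ s hs, mul_assoc, ← Real.exp_add]
      simp
    refine ⟨k / D, c₆, logDeriv f, by rw [hD], fun s hs => ⟨?_, rfl, hh' s hs, ?_, ?_, ?_, ?_⟩⟩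
    · rw [← logDeriv_apply, ← logDeriv_apply, hk' s hs]
    all_goals rw [← hD]
    · exact hA s hs
    · exact hB s hs
    · exact hqe s hs
    · rw [(dz s hs).deriv, hqe s hs, signedPow_eq (hA s hs), signedPow_eq (hB s hs),
        show (k / D + 1) / 2 - 1 = (k / D - 1) / 2 by ring,
        show (-(k / D) + 1) / 2 - 1 = (-(k / D) - 1) / 2 by ring]
      ring

end Base

end RicciHarmonic

end

/-! ### The four cases, combining the base and fiber equivalences -/

theorem theorem5 (n m : ℕ) (hn : 1 < n) (hm : 3 ≤ m)
    (ε α : Fin n → ℝ) (δ β : Fin m → ℝ)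
    (hε : ∀ i, ε i = 1 ∨ ε i = -1) (hδ : ∀ j, δ j = 1 ∨ δ j = -1)
    (hα : α ≠ 0) (hβ : β ≠ 0) (θ : ℝ) (hθ : 0 < θ)
    (I J : Set ℝ) (hI : IsOpen I) (hI' : I.OrdConnected) (hJ : IsOpen J) (hJ' : J.OrdConnected)
    (ξ₀ ζ₀ : ℝ) (hξ₀ : ξ₀ ∈ I) (hζ₀ : ζ₀ ∈ J)
    (φ f h τ u : ℝ → ℝ)
    (hφ : ContDiffOn ℝ ∞ φ I) (hf : ContDiffOn ℝ ∞ f I) (hh : ContDiffOn ℝ ∞ h I)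
    (hτ : ContDiffOn ℝ ∞ τ J) (hu : ContDiffOn ℝ ∞ u J)
    (hφ0 : ∀ ξ ∈ I, 0 < φ ξ) (hf0 : ∀ ξ ∈ I, 0 < f ξ) (hτ0 : ∀ ζ ∈ J, 0 < τ ζ)
    (hu_nc : NonConstOn u J) :
    (sqNorm ε α = 0 → sqNorm δ β = 0 →
      (IsSteadyWithSteadyFiber ε α δ β θ I J φ f h τ u ↔
        BaseNull n m I ξ₀ φ f h ∧ FiberNull m θ J ζ₀ τ u)) ∧
    (sqNorm ε α = 0 → sqNorm δ β = 1 →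
      (IsSteadyWithSteadyFiber ε α δ β θ I J φ f h τ u ↔
        BaseNull n m I ξ₀ φ f h ∧ FiberUnit m θ J τ u)) ∧
    (sqNorm ε α = 1 → sqNorm δ β = 0 → NonConstOn f I →
      (IsSteadyWithSteadyFiber ε α δ β θ I J φ f h τ u ↔
        BaseUnit n m I φ f h ∧ FiberNull m θ J ζ₀ τ u)) ∧
    (sqNorm ε α = 1 → sqNorm δ β = 1 → NonConstOn f I →
      (IsSteadyWithSteadyFiber ε α δ β θ I J φ f h τ u ↔
        BaseUnit n m I φ f h ∧ FiberUnit m θ J τ u)) := by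
  rw [isSteadyWithSteadyFiber_iff hn hm hε hδ hα hβ hθ hI hJ ⟨ζ₀, hζ₀⟩ hφ hf hh hτ hu hφ0 hf0 hτ0]
  have base0 := baseODE_null_iff (n := n) (m := m) hI hI' hξ₀ hφ hf hh hφ0 hf0
  have base1 : NonConstOn f I → (BaseODE n m 1 I φ f h ↔ BaseUnit n m I φ f h) := fun hnc =>
    ⟨unit_of_baseODE hn hm hI hI' hξ₀ hφ hf hh hφ0 hf0 hnc,
      baseODE_of_unit hn hm hI hφ hf hφ0 hf0⟩
  have fib0 := fiberODE_null_iff hm hθ hJ hJ' hζ₀ hτ hu hτ0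
  have fib1 := fiberODE_unit_iff hm hθ hJ hJ' hζ₀ hτ hu hτ0 hu_nc
  refine ⟨fun ha hb => ?_, fun ha hb => ?_, fun ha hb hnc => ?_, fun ha hb hnc => ?_⟩
  · rw [ha, hb, base0, fib0]
  · rw [ha, hb, base0, fib1]
  · rw [ha, hb, base1 hnc, fib0]
  · rw [ha, hb, base1 hnc, fib1]
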